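/- Let $K$ be a field, $S=K[x_1,\ldots,x_n]$ with graded maximal ideal $\mathfrak m=(x_1,\ldots,x_n)$, and let $I\subseteq S$ be an equigenerated monomial ideal, that is, an ideal generated by monomials of one and the same degree. Let $F(I)=\bigoplus_{k\ge 0} I^k/\mathfrak m I^k$ be its fiber cone, a standard graded $K$-algebra, let $\ell(I)=\dim F(I)$ (Krull dimension) be its analytic spread, and let $\mu(J)$ denote the minimal number of generators of an ideal $J$. The ideal $I$ is called Freiman if $\mu(I^2)=\ell(I)\mu(I)-\binom{\ell(I)}{2}$. For a standard graded $K$-algebra $R$ with Hilbert series $\sum_{k}\dim_K(R_k)\,t^k=Q(t)/(1-t)^{\dim R}$, $Q\in\mathbb Z[t]$, let $e(R)=Q(1)$ be its multiplicity and $\operatorname{embdim}(R)=\dim_K R_1$ its embedding dimension; $R$ has minimal multiplicity if $\operatorname{embdim}(R)=e(R)+\dim R-1$. (a) If $F(I)$ is Cohen–Macaulay, then $I$ is Freiman if and only if $F(I)$ has minimal multiplicity. (b) If $F(I)$ is a hypersurface ring defined by a quadratic polynomial, that is, $F(I)\cong K[z_1,\ldots,z_m]/(q)$ as graded $K$-algebras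 for some $m$ and some nonzero form $q$ of degree $2$ (with $\deg z_i=1$), then $F(I)$ is Cohen–Macaulay, $I$ is Freiman, and $F(I)$ has minimal multiplicity. -/

import Mathlib

namespace FreimanIdeal

noncomputable section

/-! ### Cohen–Macaulay rings, Krull dimension as a natural number -/

/-- The depth of a local ring: the supremum of the lengths of the regular sequences
contained in the maximal ideal. -/
def localDepth (R : Type*) [CommRing R] [IsLocalRing R] : ℕ∞ :=
  ⨆ rs : {rs : List R // (∀ r ∈ rs, r ∈ IsLocalRing.maximalIdeal R) ∧
    RingTheory.Sequence.IsRegular R rs}, (rs.1.length : ℕ∞)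

/-- A Noetherian local ring is Cohen–Macaulay if its depth equals its Krull dimension. -/
def IsCohenMacaulayLocalRing (R : Type*) [CommRing R] [IsLocalRing R] : Prop :=
  IsNoetherianRing R ∧ (localDepth R : WithBot ℕ∞) = ringKrullDim R

/-- A Noetherian ring is Cohen–Macaulay if its localizations at all maximal ideals are
Cohen–Macaulay local rings. -/
def IsCohenMacaulayRing (R : Type*) [CommRing R] : Prop :=
  IsNoetherianRing R ∧ ∀ (p : Ideal R) [p.IsMaximal],
    IsCohenMacaulayLocalRing (Localization.AtPrime p)

/-- The Krull dimension as a natural number. It is only used for nonzero finitely generated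
algebras over a field, whose Krull dimension is a natural number. -/
def krullDim (R : Type*) [CommRing R] : ℕ := ((ringKrullDim R).unbotD 0).toNat

/-! ### Invariants of a graded `K`-algebra `R` with graded components `𝒜 k` -/

section Graded

variable {K R : Type*} [Field K] [CommRing R] [Algebra K R]

/-- The Hilbert series `∑ₖ dim_K(R_k) t^k`. -/
def hilbertSeries (𝒜 : ℕ → Submodule K R) : PowerSeries ℤ :=
  PowerSeries.mk fun k => (Module.finrank K (𝒜 k) : ℤ)

/-- `e` is the multiplicity of `R`: writing the Hilbert series as `Q(t) / (1 - t) ^ dim R`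
with a polynomial `Q`, which is then unique, one has `e = Q(1)`. -/
def HasMultiplicity (𝒜 : ℕ → Submodule K R) (e : ℤ) : Prop :=
  ∃ Q : Polynomial ℤ,
    hilbertSeries 𝒜 * (1 - PowerSeries.X) ^ krullDim R = (Q : PowerSeries ℤ) ∧ Q.eval 1 = e

/-- The embedding dimension of a standard graded `K`-algebra: `dim_K(R_1)`. -/
def embDim (𝒜 : ℕ → Submodule K R) : ℕ := Module.finrank K (𝒜 1)

/-- `R` has minimal multiplicity: `embdim R = e(R) + dim R - 1`. -/
def HasMinimalMultiplicity (𝒜 : ℕ → Submodule K R) : Prop :=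
  ∃ e : ℤ, HasMultiplicity 𝒜 e ∧ (embDim 𝒜 : ℤ) = e + (krullDim R : ℤ) - 1

/-- `R` is, as a standard graded `K`-algebra, a hypersurface ring defined by a quadric:
`R ≅ K[z_1, …, z_m] / (q)` with the `z_i` in degree one and `q` a nonzero form of degree two. -/
def IsQuadricHypersurface (𝒜 : ℕ → Submodule K R) : Prop :=
  ∃ (m : ℕ) (φ : MvPolynomial (Fin m) K →ₐ[K] R) (q : MvPolynomial (Fin m) K),
    Function.Surjective φ ∧ (∀ i, φ (MvPolynomial.X i) ∈ 𝒜 1) ∧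
    q ≠ 0 ∧ q.IsHomogeneous 2 ∧ RingHom.ker φ = Ideal.span {q}

end Graded

/-! ### Fiber cones and Freiman ideals -/

section FiberCone

variable {K : Type*} [Field K] {n : ℕ}

/-- The graded maximal ideal `(x_1, …, x_n)` of `K[x_1, …, x_n]`. -/
def gradedMaximalIdeal (K : Type*) [Field K] (n : ℕ) : Ideal (MvPolynomial (Fin n) K) :=
  Ideal.span (Set.range MvPolynomial.X)

/-- The fiber cone `F(I) = ⨁ₖ I^k / 𝔪 I^k`, as the quotient of the Rees algebra
`⨁ₖ I^k t^k` by the ideal generated by `𝔪 = (x_1, …, x_n)`. -/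
def FiberCone (I : Ideal (MvPolynomial (Fin n) K)) : Type _ :=
  reesAlgebra I ⧸
    (gradedMaximalIdeal K n).map (algebraMap (MvPolynomial (Fin n) K) (reesAlgebra I))

instance (I : Ideal (MvPolynomial (Fin n) K)) : CommRing (FiberCone I) :=
  inferInstanceAs (CommRing (reesAlgebra I ⧸
    (gradedMaximalIdeal K n).map (algebraMap (MvPolynomial (Fin n) K) (reesAlgebra I))))

instance (I : Ideal (MvPolynomial (Fin n) K)) : Algebra K (FiberCone I) :=
  inferInstanceAs (Algebra K (reesAlgebra I ⧸
    (gradedMaximalIdeal K n).map (algebraMap (MvPolynomial (Fin n) K) (reesAlgebra I))))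

/-- The quotient map from the Rees algebra to the fiber cone. -/
def FiberCone.mk (I : Ideal (MvPolynomial (Fin n) K)) : reesAlgebra I →ₐ[K] FiberCone I :=
  Ideal.Quotient.mkₐ K
    ((gradedMaximalIdeal K n).map (algebraMap (MvPolynomial (Fin n) K) (reesAlgebra I)))

/-- The graded component `I^k / 𝔪 I^k` of the fiber cone: the classes of the elements
`r t^k` with `r ∈ I^k`. -/
def fiberConeGrading (I : Ideal (MvPolynomial (Fin n) K)) (k : ℕ) :
    Submodule K (FiberCone I) where
  carrier := {x | ∃ (r : MvPolynomial (Fin n) K) (hr : r ∈ I ^ k),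
    FiberCone.mk I ⟨Polynomial.monomial k r, reesAlgebra.monomial_mem.mpr hr⟩ = x}
  zero_mem' := by
    refine ⟨0, zero_mem _, ?_⟩
    rw [← map_zero (FiberCone.mk I)]
    exact congrArg _ (Subtype.ext (map_zero _))
  add_mem' := by
    rintro _ _ ⟨r, hr, rfl⟩ ⟨s, hs, rfl⟩
    refine ⟨r + s, add_mem hr hs, ?_⟩
    rw [← map_add]
    exact congrArg _ (Subtype.ext (map_add _ _ _))
  smul_mem' := by
    rintro c _ ⟨r, hr, rfl⟩
    refine ⟨c • r, Submodule.smul_of_tower_mem _ c hr, ?_⟩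
    rw [← map_smul]
    exact congrArg _ (Subtype.ext (Polynomial.smul_monomial c k r).symm)

/-- The analytic spread `ℓ(I)`: the Krull dimension of the fiber cone. -/
def analyticSpread (I : Ideal (MvPolynomial (Fin n) K)) : ℕ := krullDim (FiberCone I)

/-- The minimal number of generators `μ(I)`. -/
def mu (I : Ideal (MvPolynomial (Fin n) K)) : ℕ := Submodule.spanFinrank I

/-- `I` is an equigenerated monomial ideal: it is generated by monomials of one and the same
degree. -/
def IsEquigeneratedMonomial (I : Ideal (MvPolynomial (Fin n) K)) : Prop :=
  ∃ (d : ℕ) (A : Set (Fin n →₀ ℕ)), (∀ a ∈ A, a.degree = d) ∧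
    I = Ideal.span ((fun a => MvPolynomial.monomial a (1 : K)) '' A)

/-- `I` is a Freiman ideal: an equigenerated monomial ideal with
`μ(I^2) = ℓ(I) μ(I) - binom(ℓ(I), 2)`. -/
def IsFreiman (I : Ideal (MvPolynomial (Fin n) K)) : Prop :=
  IsEquigeneratedMonomial I ∧
    (mu (I ^ 2) : ℤ) = analyticSpread I * mu I - (analyticSpread I).choose 2

end FiberCone

end

end FreimanIdeal

namespace FreimanIdeal

section Depth

universe u

open RingTheory.Sequence CategoryTheory Abelian Pointwise

/-- If an ideal `J` contains a regular sequence of length `n + 1` on `M`, then it contains one of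
length `n` on `M / yM`, for every `M`-regular element `y` of `J`. -/
theorem exists_isRegular_quotSMulTop {A : Type u} [CommRing A] [IsNoetherianRing A] (J : Ideal A)
    (M : Type u) [AddCommGroup M] [Module A M] [Module.Finite A M]
    (hJ : J • (⊤ : Submodule A M) < ⊤) {n : ℕ} {rs : List A} (hlen : rs.length = n + 1)
    (hmem : ∀ r ∈ rs, r ∈ J) (hreg : IsRegular M rs) {y : A} (hy : y ∈ J)
    (hyreg : IsSMulRegular M y) :
    ∃ rs' : List A, rs'.length = n ∧ (∀ r ∈ rs', r ∈ J) ∧ IsRegular (QuotSMulTop y M) rs' := by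
  have h0 := (ModuleCat.exists_isRegular_tfae J (n + 1) (ModuleCat.of A M) hJ).out 3 1
  have h1 := h0.mp ⟨rs, hlen, hmem, hreg⟩
  have hlt : J • (⊤ : Submodule A (QuotSMulTop y M)) < ⊤ := by
    rw [lt_top_iff_ne_top]
    intro eq
    refine hJ.ne ?_
    have := congrArg (Submodule.comap (Submodule.mkQ _)) eq
    simpa [Submodule.comap_smul_top_of_surjective J _ (Submodule.mkQ_surjective _),
      Submodule.smul_mono_left ((Ideal.span_singleton_le_iff_mem J).mpr hy),
      ← Submodule.ideal_span_singleton_smul] using this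
  have h2 := (ModuleCat.exists_isRegular_tfae J n (ModuleCat.of A (QuotSMulTop y M)) hlt).out 1 3
  refine h2.mp fun i hi => ?_
  have zero1 := AddCommGrpCat.isZero_of_iff_subsingleton.mpr (h1 i (by omega))
  have zero2 := AddCommGrpCat.isZero_of_iff_subsingleton.mpr (h1 (i + 1) (by omega))
  have hyreg' : IsSMulRegular (ModuleCat.of A M) y := hyreg
  exact AddCommGrpCat.subsingleton_of_isZero <| ShortComplex.Exact.isZero_of_both_zeros
    ((Ext.covariant_sequence_exact₃' _ hyreg'.smulShortComplex_shortExact) i (i + 1) rfl)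
    (zero1.eq_zero_of_src _) (zero2.eq_zero_of_tgt _)

/-- Over an infinite field, a subspace generating the maximal ideal of a local ring contains
regular sequences of every length not exceeding the depth. -/
theorem exists_isRegular_mem_subspace {K : Type*} [Field K] [Infinite K] {A : Type u} [CommRing A]
    [Algebra K A] [IsNoetherianRing A] [IsLocalRing A] (V : Submodule K A)
    (hV : Ideal.span (V : Set A) = IsLocalRing.maximalIdeal A) (n : ℕ)
    (M : Type u) [AddCommGroup M] [Module A M] [Module.Finite A M] {rs : List A}
    (hlen : rs.length = n) (hmem : ∀ r ∈ rs, r ∈ IsLocalRing.maximalIdeal A)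
    (hreg : IsRegular M rs) :
    ∃ ls : List A, ls.length = n ∧ (∀ l ∈ ls, l ∈ V) ∧ IsRegular M ls := by
  induction n generalizing M rs with
  | zero =>
    have := hreg.nontrivial
    exact ⟨[], rfl, by simp, IsRegular.nil A M⟩
  | succ n ih =>
    have hnt := hreg.nontrivial
    have hlt : IsLocalRing.maximalIdeal A • (⊤ : Submodule A M) < ⊤ := by
      rw [lt_top_iff_ne_top]
      exact (Submodule.top_ne_ideal_smul_of_le_jacobson_annihilator
        (IsLocalRing.maximalIdeal_le_jacobson _)).symm
    obtain ⟨l, hlV, hlreg⟩ : ∃ l ∈ V, IsSMulRegular M l := by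
      by_contra! hcon
      have hfin : (associatedPrimes A M).Finite := associatedPrimes.finite A M
      let W : associatedPrimes A M → Submodule K V := fun p =>
        (p.1.restrictScalars K).comap V.subtype
      have : Finite (associatedPrimes A M) := hfin
      have hcov : ⋃ p, (W p : Set V) = Set.univ := by
        refine Set.eq_univ_of_forall fun v => ?_
        have hv : (v : A) ∈ ⋃ p ∈ associatedPrimes A M, (p : Set A) := by
          rw [biUnion_associatedPrimes_eq_compl_regular]
          exact hcon v v.2
        simp only [Set.mem_iUnion] at hv ⊢
        obtain ⟨p, hp, hvp⟩ := hv
        exact ⟨⟨p, hp⟩, hvp⟩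
      obtain ⟨⟨p, hp⟩, hpt⟩ := Subspace.exists_eq_top_of_iUnion_eq_univ hcov
      have hVp : IsLocalRing.maximalIdeal A ≤ p := by
        rw [← hV, Ideal.span_le]
        intro v hv
        have : (⟨v, hv⟩ : V) ∈ W ⟨p, hp⟩ := hpt ▸ Submodule.mem_top
        exact this
      match rs, hlen with
      | r :: rs, _ =>
        have hr : r ∈ ⋃ p ∈ associatedPrimes A M, (p : Set A) :=
          Set.mem_biUnion hp (hVp (hmem r (by simp)))
        rw [biUnion_associatedPrimes_eq_compl_regular] at hr
        exact hr ((isRegular_cons_iff M r rs).mp hreg).1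
    have hl : l ∈ IsLocalRing.maximalIdeal A := hV ▸ Ideal.subset_span hlV
    obtain ⟨rs', h1, h2, h3⟩ := exists_isRegular_quotSMulTop _ M hlt hlen hmem hreg hl hlreg
    obtain ⟨ls, h4, h5, h6⟩ := ih (QuotSMulTop l M) h1 h2 h3
    refine ⟨l :: ls, by simp [h4], by simpa [hlV] using h5, (isRegular_cons_iff M l ls).mpr
      ⟨hlreg, h6⟩⟩

end Depth

section StandardGraded

open RingTheory.Sequence Pointwise

/-- A standard graded algebra over a field: the degree zero part consists of the scalars, and the
algebra is generated by its degree one part, which is finite-dimensional. -/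
structure IsStandardGraded {K R : Type*} [Field K] [CommRing R] [Algebra K R]
    (𝒜 : ℕ → Submodule K R) : Prop where
  nontrivial : Nontrivial R
  zero_le : 𝒜 0 ≤ 1
  adjoin_one : Algebra.adjoin K (𝒜 1 : Set R) = ⊤
  finite_one : Module.Finite K (𝒜 1)

variable {K R : Type*} [Field K] [CommRing R] [Algebra K R]

/-- The ideal generated by the forms of degree one. -/
def irrelevantIdeal (𝒜 : ℕ → Submodule K R) : Ideal R := Ideal.span (𝒜 1 : Set R)

/-- The dimension of the image of the degree `k` part in `R / J`. -/
noncomputable def hilbertFun (𝒜 : ℕ → Submodule K R) (J : Ideal R) (k : ℕ) : ℕ :=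
  Module.finrank K ((𝒜 k).map ((J.restrictScalars K).mkQ))

variable {𝒜 : ℕ → Submodule K R} [GradedAlgebra 𝒜]

namespace IsStandardGraded

omit [GradedAlgebra 𝒜] in
theorem pow_le [SetLike.GradedMonoid 𝒜] (k : ℕ) : (𝒜 1) ^ k ≤ 𝒜 k := by
  induction k with
  | zero => rw [pow_zero, Submodule.one_le]; exact SetLike.GradedOne.one_mem
  | succ k ih =>
    rw [pow_succ, Submodule.mul_le]
    intro a ha b hb
    exact SetLike.GradedMul.mul_mem (ih ha) hb

theorem eq_pow (h : IsStandardGraded 𝒜) (k : ℕ) : 𝒜 k = (𝒜 1) ^ k := by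
  refine le_antisymm (fun x hx => ?_) (pow_le k)
  have hmon : ∀ y ∈ Submonoid.closure (𝒜 1 : Set R), ∃ j, y ∈ (𝒜 1) ^ j := by
    intro y hy
    induction hy using Submonoid.closure_induction with
    | mem y hy => exact ⟨1, by rwa [pow_one]⟩
    | one => exact ⟨0, by rw [pow_zero]; exact Submodule.one_le.mp le_rfl⟩
    | mul y z _ _ hy hz =>
      obtain ⟨i, hi⟩ := hy
      obtain ⟨j, hj⟩ := hz
      exact ⟨i + j, by rw [pow_add]; exact Submodule.mul_mem_mul hi hj⟩
  have htop : (⊤ : Submodule K R) ≤ ((𝒜 1) ^ k).comap (GradedAlgebra.proj 𝒜 k) := by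
    rw [← Algebra.top_toSubmodule, ← h.adjoin_one, Algebra.adjoin_eq_span, Submodule.span_le]
    intro y hy
    obtain ⟨j, hj⟩ := hmon y hy
    simp only [SetLike.mem_coe, Submodule.mem_comap, GradedAlgebra.proj_apply]
    by_cases hjk : j = k
    · subst hjk
      rwa [DirectSum.decompose_of_mem_same 𝒜 (pow_le j hj)]
    · rw [DirectSum.decompose_of_mem_ne 𝒜 (pow_le j hj) hjk]
      exact zero_mem _
  have := htop (Submodule.mem_top : x ∈ ⊤)
  rwa [Submodule.mem_comap, GradedAlgebra.proj_apply, DirectSum.decompose_of_mem_same 𝒜 hx]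
    at this

theorem finite (h : IsStandardGraded 𝒜) (k : ℕ) : Module.Finite K (𝒜 k) := by
  rw [h.eq_pow k, Module.Finite.iff_fg]
  exact Submodule.FG.pow (Module.Finite.iff_fg.mp h.finite_one) k

theorem mul_eq (h : IsStandardGraded 𝒜) (i j : ℕ) : 𝒜 i * 𝒜 j = 𝒜 (i + j) := by
  rw [h.eq_pow i, h.eq_pow j, h.eq_pow (i + j), pow_add]

theorem le_irrelevantIdeal_pow (h : IsStandardGraded 𝒜) (k : ℕ) {x : R} (hx : x ∈ 𝒜 k) :
    x ∈ irrelevantIdeal 𝒜 ^ k := by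
  induction k generalizing x with
  | zero => simp
  | succ k ih =>
    rw [← h.mul_eq k 1] at hx
    induction hx using Submodule.mul_induction_on' with
    | mem_mul_mem a ha b hb =>
      rw [pow_succ]
      exact Ideal.mul_mem_mul (ih ha) (Ideal.subset_span hb)
    | add x _ y _ hx hy => exact add_mem hx hy

omit [GradedAlgebra 𝒜] in
theorem exists_algebraMap (h : IsStandardGraded 𝒜) {x : R} (hx : x ∈ 𝒜 0) :
    ∃ c : K, algebraMap K R c = x := Submodule.mem_one.mp (h.zero_le hx)

theorem mem_irrelevantIdeal_iff (h : IsStandardGraded 𝒜) (x : R) :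
    x ∈ irrelevantIdeal 𝒜 ↔ ((DirectSum.decompose 𝒜 x 0 : 𝒜 0) : R) = 0 := by
  constructor
  · intro hx
    induction hx using Submodule.span_induction with
    | mem y hy => exact DirectSum.decompose_of_mem_ne 𝒜 hy one_ne_zero
    | zero => simp
    | add y z _ _ hy hz => simp [hy, hz]
    | smul a y _ hy =>
      rw [smul_eq_mul]
      change GradedRing.projZeroRingHom 𝒜 (a * y) = 0
      rw [map_mul]
      change _ * ((DirectSum.decompose 𝒜 y 0 : 𝒜 0) : R) = 0
      rw [hy, mul_zero]
  · intro hx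
    classical
    rw [← DirectSum.sum_support_decompose 𝒜 x]
    refine sum_mem fun i _ => ?_
    rcases Nat.eq_zero_or_pos i with rfl | hi
    · rw [hx]; exact zero_mem _
    · exact Ideal.pow_le_self hi.ne' (h.le_irrelevantIdeal_pow i (SetLike.coe_mem _))

theorem isMaximal_irrelevantIdeal (h : IsStandardGraded 𝒜) : (irrelevantIdeal 𝒜).IsMaximal := by
  have := h.nontrivial
  rw [Ideal.isMaximal_iff]
  constructor
  · rw [h.mem_irrelevantIdeal_iff, DirectSum.decompose_of_mem_same 𝒜 SetLike.GradedOne.one_mem]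
    exact one_ne_zero
  · intro J x hJ hx hxJ
    obtain ⟨c, hc⟩ := h.exists_algebraMap (DirectSum.decompose 𝒜 x 0).2
    have hc0 : c ≠ 0 := by
      rintro rfl
      exact hx ((h.mem_irrelevantIdeal_iff x).mpr (by rw [← hc, map_zero]))
    have h1 : x - algebraMap K R c ∈ irrelevantIdeal 𝒜 := by
      rw [h.mem_irrelevantIdeal_iff, DirectSum.decompose_sub, hc]
      simp
    have h2 : algebraMap K R c ∈ J := by
      simpa using J.sub_mem hxJ (hJ h1)
    have h3 := J.mul_mem_left (algebraMap K R c⁻¹) h2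
    rwa [← map_mul, inv_mul_cancel₀ hc0, map_one] at h3

theorem mem_of_mul_mem (h : IsStandardGraded 𝒜) {J : Ideal R} (hJ : J.IsHomogeneous 𝒜) {k : ℕ}
    {u s : R} (hu : u ∈ 𝒜 k) (hs : s ∉ irrelevantIdeal 𝒜) (hsu : s * u ∈ J) : u ∈ J := by
  obtain ⟨c, hc⟩ := h.exists_algebraMap (DirectSum.decompose 𝒜 s 0).2
  have hc0 : c ≠ 0 := by
    rintro rfl
    exact hs ((h.mem_irrelevantIdeal_iff s).mpr (by rw [← hc, map_zero]))
  have h1 := hJ k hsu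
  have h2 := DirectSum.coe_decompose_mul_add_of_right_mem 𝒜 (i := 0) (a := s) hu
  rw [zero_add] at h2
  rw [h2, ← hc] at h1
  have h3 := J.mul_mem_left (algebraMap K R c⁻¹) h1
  rwa [← mul_assoc, ← map_mul, inv_mul_cancel₀ hc0, map_one, one_mul] at h3

end IsStandardGraded

omit [GradedAlgebra 𝒜] in
theorem hilbertFun_bot (k : ℕ) : hilbertFun 𝒜 ⊥ k = Module.finrank K (𝒜 k) := by
  have hinj : Function.Injective ((⊥ : Ideal R).restrictScalars K).mkQ := by
    rw [← LinearMap.ker_eq_bot, Submodule.ker_mkQ]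
    exact Submodule.restrictScalars_bot K R R
  exact (Submodule.equivMapOfInjective _ hinj (𝒜 k)).finrank_eq.symm

theorem finrank_map_add_finrank_inf_ker {V V' : Type*} [AddCommGroup V] [Module K V]
    [AddCommGroup V'] [Module K V'] (p : Submodule K V) [Module.Finite K p] (f : V →ₗ[K] V') :
    Module.finrank K (p.map f) + Module.finrank K (p ⊓ LinearMap.ker f : Submodule K V) =
      Module.finrank K p := by
  have h := LinearMap.finrank_range_add_finrank_ker (f.domRestrict p)
  rw [LinearMap.range_domRestrict, LinearMap.ker_domRestrict] at h
  rw [← h, ← (Submodule.comapSubtypeEquivOfLe (inf_le_left : p ⊓ LinearMap.ker f ≤ p)).finrank_eq,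
    Submodule.comap_inf, Submodule.comap_subtype_self, top_inf_eq]

/-- Killing a linear form which is regular modulo `J`. -/
theorem hilbertFun_sup_succ [∀ k, Module.Finite K (𝒜 k)] {J : Ideal R} (hJ : J.IsHomogeneous 𝒜)
    {l : R} (hl : l ∈ 𝒜 1) {k : ℕ} (hreg : ∀ u ∈ 𝒜 k, l * u ∈ J → u ∈ J) :
    hilbertFun 𝒜 (J ⊔ Ideal.span {l}) (k + 1) + hilbertFun 𝒜 J k = hilbertFun 𝒜 J (k + 1) := by
  have hle : J.restrictScalars K ≤ (J ⊔ Ideal.span {l}).restrictScalars K := fun x hx =>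
    (le_sup_left : J ≤ J ⊔ Ideal.span {l}) hx
  let f := Submodule.factor hle
  have hmul : J.restrictScalars K ≤ (J.restrictScalars K).comap (LinearMap.mulLeft K l) :=
    fun x hx => J.mul_mem_left l hx
  let g := Submodule.mapQ _ _ (LinearMap.mulLeft K l) hmul
  have h1 := finrank_map_add_finrank_inf_ker ((𝒜 (k + 1)).map (J.restrictScalars K).mkQ) f
  have h2 := finrank_map_add_finrank_inf_ker ((𝒜 k).map (J.restrictScalars K).mkQ) g
  have h3 : ((𝒜 k).map (J.restrictScalars K).mkQ) ⊓ LinearMap.ker g = ⊥ := by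
    rw [eq_bot_iff]
    rintro _ ⟨⟨u, hu, rfl⟩, hker⟩
    have h4 : l * u ∈ J := (Submodule.Quotient.mk_eq_zero _).mp hker
    exact (Submodule.Quotient.mk_eq_zero _).mpr (hreg u hu h4)
  have h5 : ((𝒜 (k + 1)).map (J.restrictScalars K).mkQ) ⊓ LinearMap.ker f =
      ((𝒜 k).map (J.restrictScalars K).mkQ).map g := by
    apply le_antisymm
    · rintro _ ⟨⟨a, ha, rfl⟩, hker⟩
      have h6 : a ∈ J ⊔ Ideal.span {l} := (Submodule.Quotient.mk_eq_zero _).mp hker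
      obtain ⟨j, hj, _, hb, hab⟩ := Submodule.mem_sup.mp h6
      obtain ⟨b, rfl⟩ := Ideal.mem_span_singleton'.mp hb
      refine ⟨_, ⟨DirectSum.decompose 𝒜 b k, SetLike.coe_mem _, rfl⟩, ?_⟩
      refine ((Submodule.Quotient.eq _).mpr ?_).symm
      have h7 := congrArg (fun x => ((DirectSum.decompose 𝒜 x (k + 1) : 𝒜 (k + 1)) : R)) hab
      simp only [DirectSum.decompose_add, DirectSum.add_apply, Submodule.coe_add,
        DirectSum.decompose_of_mem_same 𝒜 ha,
        DirectSum.coe_decompose_mul_add_of_right_mem 𝒜 hl] at h7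
      rw [← h7, LinearMap.mulLeft_apply, mul_comm l, add_sub_cancel_right]
      exact hJ _ hj
    · rintro _ ⟨_, ⟨b, hb, rfl⟩, rfl⟩
      refine ⟨⟨l * b, add_comm k 1 ▸ SetLike.GradedMul.mul_mem hl hb, rfl⟩, ?_⟩
      refine (Submodule.Quotient.mk_eq_zero _).mpr ?_
      exact Ideal.mul_mem_right _ _ (le_sup_right (a := J) (Ideal.mem_span_singleton_self l))
  rw [h3, finrank_bot, add_zero] at h2
  rw [h5, h2, ← Submodule.map_comp, Submodule.factor_comp_mk] at h1
  exact h1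

theorem hilbertFun_sup_zero {J : Ideal R} (hJ : J.IsHomogeneous 𝒜) {l : R} (hl : l ∈ 𝒜 1) :
    hilbertFun 𝒜 (J ⊔ Ideal.span {l}) 0 = hilbertFun 𝒜 J 0 := by
  have hle : J.restrictScalars K ≤ (J ⊔ Ideal.span {l}).restrictScalars K := fun x hx =>
    (le_sup_left : J ≤ J ⊔ Ideal.span {l}) hx
  let f := Submodule.factor hle
  have h3 : Disjoint ((𝒜 0).map (J.restrictScalars K).mkQ) (LinearMap.ker f) := by
    rw [Submodule.disjoint_def]
    rintro _ ⟨a, ha, rfl⟩ hker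
    have h6 : a ∈ J ⊔ Ideal.span {l} := (Submodule.Quotient.mk_eq_zero _).mp hker
    obtain ⟨j, hj, _, hb, hab⟩ := Submodule.mem_sup.mp h6
    obtain ⟨b, rfl⟩ := Ideal.mem_span_singleton'.mp hb
    have h7 := congrArg (fun x => ((DirectSum.decompose 𝒜 x 0 : 𝒜 0) : R)) hab
    simp only [DirectSum.decompose_add, DirectSum.add_apply, Submodule.coe_add,
      DirectSum.decompose_of_mem_same 𝒜 ha] at h7
    rw [DirectSum.coe_decompose_mul_of_right_mem_of_not_le 𝒜 hl (by simp), add_zero] at h7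
    exact (Submodule.Quotient.mk_eq_zero _).mpr (h7 ▸ hJ 0 hj)
  unfold hilbertFun
  rw [← Submodule.factor_comp_mk hle, Submodule.map_comp]
  have hinj : Function.Injective (f.domRestrict ((𝒜 0).map (J.restrictScalars K).mkQ)) :=
    LinearMap.injective_domRestrict_iff.mpr h3
  rw [← LinearMap.range_domRestrict]
  exact (LinearEquiv.ofInjective _ hinj).finrank_eq.symm

variable (𝒜) in
/-- The generating function of `hilbertFun`. -/
noncomputable def quotientSeries (J : Ideal R) : PowerSeries ℤ :=
  PowerSeries.mk fun k => (hilbertFun 𝒜 J k : ℤ)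

theorem quotientSeries_sup [∀ k, Module.Finite K (𝒜 k)] {J : Ideal R} (hJ : J.IsHomogeneous 𝒜)
    {l : R} (hl : l ∈ 𝒜 1) (hreg : ∀ k, ∀ u ∈ 𝒜 k, l * u ∈ J → u ∈ J) :
    quotientSeries 𝒜 (J ⊔ Ideal.span {l}) = quotientSeries 𝒜 J * (1 - PowerSeries.X) := by
  ext k
  rw [mul_sub, mul_one, map_sub]
  rcases k with _ | k
  · simp [quotientSeries, hilbertFun_sup_zero hJ hl]
  · rw [PowerSeries.coeff_succ_mul_X]
    simp only [quotientSeries, PowerSeries.coeff_mk]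
    rw [← hilbertFun_sup_succ hJ hl (hreg k)]
    push_cast
    ring

omit [GradedAlgebra 𝒜] in
theorem quotientSeries_bot : quotientSeries 𝒜 ⊥ = hilbertSeries 𝒜 := by
  ext k
  simp [quotientSeries, hilbertSeries, hilbertFun_bot]

theorem isHomogeneous_ofList {ls : List R} (hls : ∀ l ∈ ls, l ∈ 𝒜 1) :
    (Ideal.ofList ls).IsHomogeneous 𝒜 :=
  Ideal.homogeneous_span 𝒜 _ fun x hx => ⟨1, hls x hx⟩

/-- The Hilbert series modulo linear forms which form a regular sequence in the localization at
the irrelevant ideal. -/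
theorem IsStandardGraded.quotientSeries_ofList (h : IsStandardGraded 𝒜)
    [(irrelevantIdeal 𝒜).IsPrime] {A : Type*} [CommRing A] [Algebra R A]
    [IsLocalization.AtPrime A (irrelevantIdeal 𝒜)] (ls : List R) (hls : ∀ l ∈ ls, l ∈ 𝒜 1)
    (hreg : IsWeaklyRegular A (ls.map (algebraMap R A))) :
    quotientSeries 𝒜 (Ideal.ofList ls) = hilbertSeries 𝒜 * (1 - PowerSeries.X) ^ ls.length := by
  have := h.finite
  induction ls using List.reverseRecOn with
  | nil => simp [quotientSeries_bot]
  | append_singleton ls l ih =>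
    rw [List.map_append, isWeaklyRegular_append_iff] at hreg
    have hls' : ∀ l ∈ ls, l ∈ 𝒜 1 := fun x hx => hls x (by simp [hx])
    have hl : l ∈ 𝒜 1 := hls l (by simp)
    have hhom := isHomogeneous_ofList hls'
    rw [Ideal.ofList_append, Ideal.ofList_singleton, quotientSeries_sup hhom hl,
      ih hls' hreg.1, List.length_append, List.length_singleton, pow_succ, mul_assoc]
    intro k u hu hlu
    have h1 : IsSMulRegular (A ⧸ Ideal.ofList (ls.map (algebraMap R A)) • (⊤ : Submodule A A))
        (algebraMap R A l) := by
      have := hreg.2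
      rwa [List.map_singleton, isWeaklyRegular_singleton_iff] at this
    have h2 : algebraMap R A u ∈ (Ideal.ofList ls).map (algebraMap R A) := by
      rw [Ideal.map_ofList]
      have h3 := Ideal.mem_map_of_mem (algebraMap R A) hlu
      rw [Ideal.map_ofList] at h3
      have h4 := isSMulRegular_iff_right_eq_zero_of_smul.mp h1
        (Submodule.Quotient.mk (algebraMap R A u)) (by
          rw [← Submodule.Quotient.mk_smul, Submodule.Quotient.mk_eq_zero,
            smul_eq_mul (_ : A), ← map_mul]
          simpa using h3)
      rw [Submodule.Quotient.mk_eq_zero] at h4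
      simpa using h4
    obtain ⟨s, hs⟩ := (IsLocalization.algebraMap_mem_map_algebraMap_iff
      (irrelevantIdeal 𝒜).primeCompl A _ _).mp h2
    exact h.mem_of_mul_mem hhom hu hs.1 hs.2

end StandardGraded

section Dimension

theorem ringKrullDim_le_of_isIntegral (A B : Type*) [CommRing A] [CommRing B] [Algebra A B]
    [Algebra.IsIntegral A B] : ringKrullDim B ≤ ringKrullDim A :=
  Order.krullDim_le_of_strictMono (PrimeSpectrum.comap (algebraMap A B)) fun _ _ h =>
    Ideal.IsIntegral.comap_lt_comap h

theorem height_le_height_under_of_isIntegral (A : Type*) {B : Type*} [CommRing A] [CommRing B]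
    [Algebra A B] [Algebra.IsIntegral A B] (P : Ideal B) [P.IsPrime] :
    P.height ≤ (P.under A).height := by
  have h := Order.height_le_height_apply_of_strictMono (PrimeSpectrum.comap (algebraMap A B))
    (fun _ _ h => Ideal.IsIntegral.comap_lt_comap h) ⟨P, inferInstance⟩
  rw [← PrimeSpectrum.height_eq_orderHeight, ← PrimeSpectrum.height_eq_orderHeight] at h
  exact h

theorem ringKrullDim_le_of_faithfullyFlat (A B : Type*) [CommRing A] [CommRing B] [Algebra A B]
    [Module.FaithfullyFlat A B] : ringKrullDim A ≤ ringKrullDim B := by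
  refine iSup_le fun l => ?_
  obtain ⟨P, hP⟩ := PrimeSpectrum.comap_surjective_of_faithfullyFlat (A := A) (B := B) l.last
  have : P.asIdeal.LiesOver l.last.asIdeal := ⟨by rw [← hP]; rfl⟩
  obtain ⟨L, hL, -⟩ := Ideal.exists_ltSeries_of_hasGoingDown l P.asIdeal
  rw [← hL]
  exact le_iSup_of_le L le_rfl

end Dimension

section LinearForms

open RingTheory.Sequence

variable {K R : Type*} [Field K] [CommRing R] [Algebra K R] {𝒜 : ℕ → Submodule K R}
  [GradedAlgebra 𝒜]

theorem IsStandardGraded.le_of_le (h : IsStandardGraded 𝒜) {J : Ideal R} {N k : ℕ}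
    (hN : 𝒜 N ≤ J.restrictScalars K) (hk : N ≤ k) : 𝒜 k ≤ J.restrictScalars K := by
  obtain ⟨m, rfl⟩ := Nat.exists_eq_add_of_le hk
  rw [← h.mul_eq, Submodule.mul_le]
  exact fun a ha b _ => J.mul_mem_right b (hN ha)

/-- A standard graded algebra has dimension at most `d` if it is finite over the subalgebra
generated by `d` linear forms. -/
theorem IsStandardGraded.ringKrullDim_le (h : IsStandardGraded 𝒜) (ls : List R)
    (hls : ∀ l ∈ ls, l ∈ 𝒜 1) {N : ℕ} (hN : 𝒜 N ≤ (Ideal.ofList ls).restrictScalars K) :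
    ringKrullDim R ≤ ls.length := by
  classical
  let φ : MvPolynomial (Fin ls.length) K →ₐ[K] R := MvPolynomial.aeval ls.get
  let _ : Algebra (MvPolynomial (Fin ls.length) K) R := φ.toRingHom.toAlgebra
  have htower : IsScalarTower K (MvPolynomial (Fin ls.length) K) R :=
    IsScalarTower.of_algebraMap_eq fun c => (φ.commutes c).symm
  have hfin : Module.Finite (MvPolynomial (Fin ls.length) K) R := by
    have hW : (⨆ k ∈ Finset.range (N + 1), 𝒜 k).FG :=
      Submodule.fg_biSup _ _ fun k _ => Module.Finite.iff_fg.mp (h.finite k)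
    obtain ⟨T, hT⟩ := hW
    refine ⟨⟨T, ?_⟩⟩
    set M := Submodule.span (MvPolynomial (Fin ls.length) K) (T : Set R) with hM
    have hstep : ∀ k, (∀ x ∈ 𝒜 k, x ∈ M) → ∀ y ∈ Ideal.ofList ls,
        ((DirectSum.decompose 𝒜 y (k + 1) : 𝒜 (k + 1)) : R) ∈ M := by
      intro k hk y hy
      induction hy using Submodule.closure_induction with
      | zero => simp
      | add y z _ _ hy hz =>
        rw [DirectSum.decompose_add]
        exact add_mem hy hz
      | smul_mem r l hl =>
        rw [smul_eq_mul, DirectSum.coe_decompose_mul_add_of_right_mem 𝒜 (hls l hl)]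
        obtain ⟨i, hi⟩ := List.get_of_mem hl
        have h1 := M.smul_mem (MvPolynomial.X i)
          (hk _ (SetLike.coe_mem (DirectSum.decompose 𝒜 r k)))
        rw [Algebra.smul_def, mul_comm] at h1
        have h2 : algebraMap (MvPolynomial (Fin ls.length) K) R (MvPolynomial.X i) = l := by
          rw [← hi]
          exact MvPolynomial.aeval_X _ _
        rwa [h2] at h1
    have hall : ∀ k, ∀ x ∈ 𝒜 k, x ∈ M := by
      intro k
      induction k with
      | zero =>
        intro x hx
        have h3 : x ∈ Submodule.span K (T : Set R) :=
          hT ▸ Submodule.mem_iSup_of_mem 0 (Submodule.mem_iSup_of_mem (by simp) hx)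
        exact Submodule.span_le_restrictScalars K _ _ h3
      | succ k ih =>
        intro x hx
        by_cases hk : k + 1 < N + 1
        · have h3 : x ∈ Submodule.span K (T : Set R) :=
            hT ▸ Submodule.mem_iSup_of_mem (k + 1)
              (Submodule.mem_iSup_of_mem (by simpa using hk) hx)
          exact Submodule.span_le_restrictScalars K _ _ h3
        · have h4 := hstep k ih x (h.le_of_le hN (by omega) hx)
          rwa [DirectSum.decompose_of_mem_same 𝒜 hx] at h4
    rw [eq_top_iff]
    intro x _
    rw [← DirectSum.sum_support_decompose 𝒜 x]
    exact sum_mem fun i _ => hall i _ (SetLike.coe_mem _)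
  have h5 := ringKrullDim_le_of_isIntegral (MvPolynomial (Fin ls.length) K) R
  rw [MvPolynomial.ringKrullDim_of_isNoetherianRing, ringKrullDim_eq_zero_of_field] at h5
  simpa using h5

/-- If the localization at the irrelevant ideal is Cohen-Macaulay and the ground field is infinite,
then there is a linear system of parameters which computes the Hilbert series. -/
theorem IsStandardGraded.exists_linear_forms {K : Type*} {R : Type*} [Field K] [CommRing R]
    [Algebra K R] {𝒜 : ℕ → Submodule K R} [GradedAlgebra 𝒜] [Infinite K] (h : IsStandardGraded 𝒜)
    [(irrelevantIdeal 𝒜).IsPrime]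
    {A : Type*} [CommRing A] [IsLocalRing A] [IsNoetherianRing A] [Algebra R A] [Algebra K A]
    [IsScalarTower K R A] [IsLocalization.AtPrime A (irrelevantIdeal 𝒜)] (rs : List A)
    (hreg : IsRegular A rs) (hmem : ∀ r ∈ rs, r ∈ IsLocalRing.maximalIdeal A)
    (hdim : ringKrullDim A ≤ rs.length) :
    ∃ ls : List R, ls.length = rs.length ∧ (∀ l ∈ ls, l ∈ 𝒜 1) ∧
      quotientSeries 𝒜 (Ideal.ofList ls) = hilbertSeries 𝒜 * (1 - PowerSeries.X) ^ rs.length ∧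
      ∃ N, 𝒜 N ≤ (Ideal.ofList ls).restrictScalars K := by
  have hmap := IsLocalization.AtPrime.map_eq_maximalIdeal (irrelevantIdeal 𝒜) A
  let V : Submodule K A := (𝒜 1).map (IsScalarTower.toAlgHom K R A).toLinearMap
  have hV : Ideal.span (V : Set A) = IsLocalRing.maximalIdeal A := by
    have h0 : (irrelevantIdeal 𝒜).map (algebraMap R A) =
        Ideal.span (algebraMap R A '' (𝒜 1 : Set R)) := Ideal.map_span _ _
    rw [← hmap, h0]
    rfl
  obtain ⟨ls', hlen, hlV, hlreg⟩ := exists_isRegular_mem_subspace V hV rs.length A rfl hmem hreg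
  have hex : ∀ l ∈ ls', ∃ r ∈ 𝒜 1, algebraMap R A r = l := fun l hl => hlV l hl
  choose! g hg using hex
  have hgmap : (ls'.map g).map (algebraMap R A) = ls' := by
    rw [List.map_map]
    exact (List.map_congr_left fun l hl => (hg l hl).2).trans (List.map_id _)
  have hmem1 : ∀ l ∈ ls'.map g, l ∈ 𝒜 1 := by
    intro l hl
    obtain ⟨l', hl', rfl⟩ := List.mem_map.mp hl
    exact (hg l' hl').1
  have hlen' : (ls'.map g).length = rs.length := by rw [List.length_map, hlen]
  refine ⟨ls'.map g, hlen', hmem1, ?_, ?_⟩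
  · rw [← hlen']
    exact h.quotientSeries_ofList (A := A) _ hmem1 (hgmap.symm ▸ hlreg.1)
  · have hd := ringKrullDim_add_length_eq_ringKrullDim_of_isRegular ls' hlreg
    rw [← hd, hlen] at hdim
    have hnt : Nontrivial (A ⧸ Ideal.ofList ls') := by
      rw [Ideal.Quotient.nontrivial_iff]
      have := hlreg.2
      simpa using this.symm
    have hd0 : ringKrullDim (A ⧸ Ideal.ofList ls') ≤ 0 := by
      generalize ringKrullDim (A ⧸ Ideal.ofList ls') = x at hdim
      induction x with
      | bot => exact bot_le
      | coe x =>
        norm_cast at hdim ⊢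
        induction x with
        | top => simp at hdim
        | coe x =>
          norm_cast at hdim ⊢
          omega
    have : Ring.KrullDimLE 0 (A ⧸ Ideal.ofList ls') := by
      rw [Ring.krullDimLE_iff]
      exact_mod_cast hd0
    have : IsArtinianRing (A ⧸ Ideal.ofList ls') :=
      isArtinianRing_iff_isNoetherianRing_krullDimLE_zero.mpr ⟨inferInstance, inferInstance⟩
    obtain ⟨N, hN⟩ := IsArtinianRing.isNilpotent_jacobson_bot (R := A ⧸ Ideal.ofList ls')
    refine ⟨N, fun x hx => ?_⟩
    have h1 : algebraMap R A x ∈ IsLocalRing.maximalIdeal A ^ N := by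
      rw [← hmap, ← Ideal.map_pow]
      exact Ideal.mem_map_of_mem _ (h.le_irrelevantIdeal_pow N hx)
    have h2 : algebraMap R A x ∈ (Ideal.ofList (ls'.map g)).map (algebraMap R A) := by
      rw [Ideal.map_ofList, hgmap, ← Ideal.Quotient.eq_zero_iff_mem]
      have h3 := Ideal.mem_map_of_mem (Ideal.Quotient.mk (Ideal.ofList ls')) h1
      rw [Ideal.map_pow] at h3
      have h4 : (IsLocalRing.maximalIdeal A).map (Ideal.Quotient.mk (Ideal.ofList ls')) ≤
          Ideal.jacobson ⊥ := by
        rw [Ideal.map_le_iff_le_comap, Ideal.comap_jacobson_of_surjective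
          Ideal.Quotient.mk_surjective, ← RingHom.ker_eq_comap_bot, Ideal.mk_ker]
        exact IsLocalRing.maximalIdeal_le_jacobson _
      have h5 := Ideal.pow_right_mono h4 N h3
      rw [hN] at h5
      exact h5
    obtain ⟨s, hs, hsx⟩ := (IsLocalization.algebraMap_mem_map_algebraMap_iff
      (irrelevantIdeal 𝒜).primeCompl A _ _).mp h2
    exact h.mem_of_mul_mem (isHomogeneous_ofList hmem1) hx hs hsx

end LinearForms

section CohenMacaulay

open RingTheory.Sequence

theorem isRegular_length_le_ringKrullDim {A : Type*} [CommRing A] [IsLocalRing A]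
    [IsNoetherianRing A] {rs : List A} (hreg : IsRegular A rs) :
    (rs.length : WithBot ℕ∞) ≤ ringKrullDim A := by
  rw [← ringKrullDim_add_length_eq_ringKrullDim_of_isRegular rs hreg]
  have : Nontrivial (A ⧸ Ideal.ofList rs) := by
    rw [Ideal.Quotient.nontrivial_iff]
    simpa using hreg.2.symm
  exact le_add_of_nonneg_left ringKrullDim_nonneg_of_nontrivial

theorem IsCohenMacaulayLocalRing.exists_isRegular {A : Type*} [CommRing A] [IsLocalRing A]
    (h : IsCohenMacaulayLocalRing A) :
    ∃ rs : List A, (∀ r ∈ rs, r ∈ IsLocalRing.maximalIdeal A) ∧ IsRegular A rs ∧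
      ringKrullDim A = rs.length := by
  have := h.1
  have hlt : localDepth A < ⊤ := by
    have h1 : ringKrullDim A < ⊤ := ringKrullDim_lt_top
    rw [← h.2] at h1
    exact WithBot.coe_lt_coe.mp h1
  have : Nonempty {rs : List A // (∀ r ∈ rs, r ∈ IsLocalRing.maximalIdeal A) ∧ IsRegular A rs} :=
    ⟨⟨[], by simp, IsRegular.nil A A⟩⟩
  obtain ⟨⟨rs, h1, h2⟩, h3⟩ := ENat.exists_eq_iSup_of_lt_top hlt
  refine ⟨rs, h1, h2, ?_⟩
  rw [← h.2, localDepth, ← h3]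
  rfl

theorem isCohenMacaulayLocalRing_of_isRegular {A : Type*} [CommRing A] [IsLocalRing A]
    [IsNoetherianRing A] {rs : List A} (hmem : ∀ r ∈ rs, r ∈ IsLocalRing.maximalIdeal A)
    (hreg : IsRegular A rs) (hdim : ringKrullDim A ≤ rs.length) : IsCohenMacaulayLocalRing A := by
  refine ⟨inferInstance, ?_⟩
  have hd := le_antisymm hdim (isRegular_length_le_ringKrullDim hreg)
  have h1 : localDepth A = rs.length := by
    apply le_antisymm
    · refine iSup_le fun rs' => ?_
      have := isRegular_length_le_ringKrullDim rs'.2.2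
      rw [hd] at this
      exact_mod_cast this
    · exact le_iSup_of_le
        (f := fun rs : {rs : List A // (∀ r ∈ rs, r ∈ IsLocalRing.maximalIdeal A) ∧
          IsRegular A rs} => (rs.1.length : ℕ∞)) ⟨rs, hmem, hreg⟩ le_rfl
  rw [hd, h1]
  rfl

/-- A flat integral extension preserves the existence of regular systems of parameters in the
localizations. -/
theorem exists_isRegular_localization_of_flat_isIntegral {R R' : Type*} [CommRing R] [CommRing R']
    [Algebra R R'] [Module.Flat R R'] [Algebra.IsIntegral R R'] [IsNoetherianRing R']
    (P : Ideal R) [P.IsPrime] (P' : Ideal R') [P'.IsPrime] (hP : P = P'.under R)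
    {rs : List (Localization.AtPrime P)}
    (hmem : ∀ r ∈ rs, r ∈ IsLocalRing.maximalIdeal (Localization.AtPrime P))
    (hreg : IsRegular (Localization.AtPrime P) rs)
    (hdim : ringKrullDim (Localization.AtPrime P) ≤ rs.length) :
    ∃ rs' : List (Localization.AtPrime P'), rs'.length = rs.length ∧
      (∀ r ∈ rs', r ∈ IsLocalRing.maximalIdeal (Localization.AtPrime P')) ∧
      IsRegular (Localization.AtPrime P') rs' ∧
      ringKrullDim (Localization.AtPrime P') ≤ rs.length := by
  let f := Localization.localRingHom P P' (algebraMap R R') hP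
  have hflat : f.Flat := RingHom.Flat.localRingHom
    ((RingHom.flat_algebraMap_iff).mpr inferInstance) _ _ hP
  let _ := f.toAlgebra
  have : Module.Flat (Localization.AtPrime P) (Localization.AtPrime P') := hflat
  have : IsNoetherianRing (Localization.AtPrime P') :=
    IsLocalization.isNoetherianRing P'.primeCompl _ inferInstance
  have hmem' : ∀ r ∈ rs.map f, r ∈ IsLocalRing.maximalIdeal (Localization.AtPrime P') := by
    intro r hr
    obtain ⟨s, hs, rfl⟩ := List.mem_map.mp hr
    have : IsLocalHom f := Localization.isLocalHom_localRingHom P P' _ hP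
    exact (map_mem_nonunits_iff f s).mpr (hmem s hs)
  refine ⟨rs.map f, by simp, hmem', ?_, ?_⟩
  · exact (IsLocalRing.isRegular_iff_isWeaklyRegular_of_subset_maximalIdeal hmem').mpr
      (IsWeaklyRegular.of_flat (S := Localization.AtPrime P') hreg.1)
  · refine le_trans ?_ hdim
    rw [IsLocalization.AtPrime.ringKrullDim_eq_height P',
      IsLocalization.AtPrime.ringKrullDim_eq_height P, hP]
    exact_mod_cast height_le_height_under_of_isIntegral R P'

end CohenMacaulay

section BaseChange

open TensorProduct

variable {K R : Type*} [Field K] [CommRing R] [Algebra K R] {𝒜 : ℕ → Submodule K R}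
  [GradedAlgebra 𝒜] (L : Type*) [Field L] [Algebra K L]

omit [GradedAlgebra 𝒜] in
theorem hilbertSeries_baseChange :
    hilbertSeries (fun k => (𝒜 k).baseChange L) = hilbertSeries 𝒜 := by
  ext k
  simp only [hilbertSeries, PowerSeries.coeff_mk]
  rw [← (Submodule.toBaseChange.toLinearEquiv L (𝒜 k)).finrank_eq, Module.finrank_baseChange]

omit [GradedAlgebra 𝒜] in
theorem IsStandardGraded.baseChange (h : IsStandardGraded 𝒜) :
    IsStandardGraded (fun k => (𝒜 k).baseChange L) where
  nontrivial := by
    have := h.nontrivial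
    exact (Algebra.TensorProduct.includeRight_injective (A := L) (B := R)
      (algebraMap K L).injective).nontrivial
  zero_le := by
    rw [Submodule.baseChange_eq_span, Submodule.span_le]
    rintro _ ⟨x, hx, rfl⟩
    obtain ⟨c, rfl⟩ := h.exists_algebraMap hx
    refine Submodule.mem_one.mpr ⟨algebraMap K L c, ?_⟩
    rw [← IsScalarTower.algebraMap_apply, Algebra.TensorProduct.algebraMap_apply']
    rfl
  adjoin_one := by
    rw [eq_top_iff]
    intro x _
    induction x using TensorProduct.induction_on with
    | zero => exact zero_mem _
    | add x y hx hy => exact add_mem (hx trivial) (hy trivial)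
    | tmul a r =>
      have h1 : ∀ r ∈ Algebra.adjoin K (𝒜 1 : Set R), (1 : L) ⊗ₜ[K] r ∈
          Algebra.adjoin L (((𝒜 1).baseChange L : Submodule L (L ⊗[K] R)) : Set (L ⊗[K] R)) := by
        intro r hr
        have h2 : Algebra.adjoin K (𝒜 1 : Set R) ≤ ((Algebra.adjoin L
            (((𝒜 1).baseChange L : Submodule L (L ⊗[K] R)) : Set (L ⊗[K] R))).restrictScalars
              K).comap Algebra.TensorProduct.includeRight := by
          rw [Algebra.adjoin_le_iff]
          intro x hx
          exact Algebra.subset_adjoin (Submodule.tmul_mem_baseChange_of_mem 1 hx)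
        exact h2 hr
      have h3 := Subalgebra.smul_mem _ (h1 r (by rw [h.adjoin_one]; trivial)) a
      rwa [TensorProduct.smul_tmul', smul_eq_mul, mul_one] at h3
  finite_one := by
    have := h.finite_one
    exact Module.Finite.equiv (Submodule.toBaseChange.toLinearEquiv L (𝒜 1))

end BaseChange

section HVector

variable {K R : Type*} [Field K] [CommRing R] [Algebra K R] {𝒜 : ℕ → Submodule K R}
  [GradedAlgebra 𝒜]

omit [GradedAlgebra 𝒜] in
theorem IsStandardGraded.isNoetherianRing (h : IsStandardGraded 𝒜) : IsNoetherianRing R := by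
  obtain ⟨T, hT⟩ := Module.Finite.iff_fg.mp h.finite_one
  have : Algebra.FiniteType K R := ⟨⟨T, by
    rw [← Algebra.adjoin_span, hT, h.adjoin_one]⟩⟩
  exact Algebra.FiniteType.isNoetherianRing K R

omit [GradedAlgebra 𝒜] in
theorem hilbertFun_eq_zero {J : Ideal R} {k : ℕ} (hk : 𝒜 k ≤ J.restrictScalars K) :
    hilbertFun 𝒜 J k = 0 := by
  have : (𝒜 k).map (J.restrictScalars K).mkQ = ⊥ := by
    rw [← LinearMap.le_ker_iff_map, Submodule.ker_mkQ]
    exact hk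
  rw [hilbertFun, this, finrank_bot]

omit [GradedAlgebra 𝒜] in
theorem le_of_hilbertFun_eq_zero {J : Ideal R} {k : ℕ} [Module.Finite K (𝒜 k)]
    (hk : hilbertFun 𝒜 J k = 0) : 𝒜 k ≤ J.restrictScalars K := by
  have : (𝒜 k).map (J.restrictScalars K).mkQ = ⊥ := Submodule.finrank_eq_zero.mp hk
  rwa [← LinearMap.le_ker_iff_map, Submodule.ker_mkQ] at this

open TensorProduct in
attribute [local instance] Algebra.TensorProduct.rightAlgebra in
/-- The `h`-vector of a standard graded Cohen-Macaulay algebra. -/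
theorem IsStandardGraded.exists_hVector (h : IsStandardGraded 𝒜) (hCM : IsCohenMacaulayRing R) :
    ∃ hv : ℕ → ℕ, (∃ N, ∀ k, N ≤ k → hv k = 0) ∧ (hv 2 = 0 → ∀ k, 2 ≤ k → hv k = 0) ∧
      hilbertSeries 𝒜 * (1 - PowerSeries.X) ^ krullDim R =
        PowerSeries.mk fun k => (hv k : ℤ) := by
  let L := AlgebraicClosure K
  let ℬ : ℕ → Submodule L (L ⊗[K] R) := fun k => (𝒜 k).baseChange L
  have h' : IsStandardGraded ℬ := h.baseChange L
  let e : R ⊗[K] L ≃ₐ[R] L ⊗[K] R := Algebra.IsPushout.equiv K R L (L ⊗[K] R)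
  have : Module.FaithfullyFlat R (L ⊗[K] R) :=
    Module.FaithfullyFlat.of_linearEquiv _ _ e.symm.toLinearEquiv
  have : Algebra.IsIntegral R (L ⊗[K] R) :=
    Algebra.IsIntegral.of_surjective e.toAlgHom e.surjective
  have hmax := h.isMaximal_irrelevantIdeal
  have hmax' := h'.isMaximal_irrelevantIdeal
  have := h'.isNoetherianRing
  have := h'.finite
  have hPP : irrelevantIdeal 𝒜 = (irrelevantIdeal ℬ).under R := by
    refine hmax.eq_of_le (Ideal.IsPrime.ne_top inferInstance) (Ideal.span_le.mpr fun x hx => ?_)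
    exact Ideal.subset_span (Submodule.tmul_mem_baseChange_of_mem 1 hx)
  obtain ⟨rs, hmem, hreg, hdim⟩ := (hCM.2 (irrelevantIdeal 𝒜)).exists_isRegular
  obtain ⟨rs', hlen, hmem', hreg', hdim'⟩ := exists_isRegular_localization_of_flat_isIntegral
    (irrelevantIdeal 𝒜) (irrelevantIdeal ℬ) hPP hmem hreg hdim.le
  have : IsNoetherianRing (Localization.AtPrime (irrelevantIdeal ℬ)) :=
    IsLocalization.isNoetherianRing (irrelevantIdeal ℬ).primeCompl _ inferInstance
  obtain ⟨ls, hlen2, hls, hser, N, hN⟩ := h'.exists_linear_forms rs' hreg' hmem' (hlen ▸ hdim')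
  have hkd : ringKrullDim R = rs.length := by
    apply le_antisymm
    · refine (ringKrullDim_le_of_faithfullyFlat R (L ⊗[K] R)).trans ?_
      rw [← hlen, ← hlen2]
      exact h'.ringKrullDim_le ls hls hN
    · rw [← hdim, IsLocalization.AtPrime.ringKrullDim_eq_height (irrelevantIdeal 𝒜)]
      exact Ideal.height_le_ringKrullDim_of_ne_top hmax.ne_top
  have hkd' : krullDim R = rs.length := by
    rw [krullDim, hkd]
    rfl
  refine ⟨hilbertFun ℬ (Ideal.ofList ls), ⟨N, fun k hk => hilbertFun_eq_zero (h'.le_of_le hN hk)⟩,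
    fun h2 k hk => hilbertFun_eq_zero (h'.le_of_le (le_of_hilbertFun_eq_zero h2) hk), ?_⟩
  rw [hkd', ← hlen, ← hilbertSeries_baseChange L, ← hser]
  rfl

end HVector

section FiberConeGraded

open MvPolynomial

variable {K : Type*} [Field K] {n : ℕ} (I : Ideal (MvPolynomial (Fin n) K))

theorem gradedMaximalIdeal_eq : gradedMaximalIdeal K n = idealOfVars (Fin n) K := rfl

theorem sub_C_mem_gradedMaximalIdeal (r : MvPolynomial (Fin n) K) :
    r - C (coeff 0 r) ∈ gradedMaximalIdeal K n := by
  classical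
  rw [gradedMaximalIdeal_eq, ← pow_one (idealOfVars _ _), mem_pow_idealOfVars_iff']
  intro x hx
  have : x = 0 := by
    rw [← Finsupp.degree_eq_zero_iff]
    omega
  subst this
  simp

/-- The class of `r t ^ k` in the fiber cone, for `r ∈ I ^ k`. -/
noncomputable def FiberCone.component (k : ℕ) : ↥(I ^ k) →ₗ[K] FiberCone I where
  toFun r := FiberCone.mk I ⟨Polynomial.monomial k r.1, reesAlgebra.monomial_mem.mpr r.2⟩
  map_add' r s := by
    rw [← map_add]
    exact congrArg _ (Subtype.ext (map_add _ _ _))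
  map_smul' c r := by
    rw [RingHom.id_apply, ← map_smul]
    exact congrArg _ (Subtype.ext (Polynomial.smul_monomial c k r.1).symm)

theorem FiberCone.component_mem {k : ℕ} (r : ↥(I ^ k)) :
    FiberCone.component I k r ∈ fiberConeGrading I k := ⟨r.1, r.2, rfl⟩

theorem FiberCone.component_mul {i j : ℕ} (a : ↥(I ^ i)) (b : ↥(I ^ j))
    (h : a.1 * b.1 ∈ I ^ (i + j)) : FiberCone.component I i a * FiberCone.component I j b =
      FiberCone.component I (i + j) ⟨a.1 * b.1, h⟩ := by
  change FiberCone.mk I ⟨Polynomial.monomial i a.1, reesAlgebra.monomial_mem.mpr a.2⟩ *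
    FiberCone.mk I ⟨Polynomial.monomial j b.1, reesAlgebra.monomial_mem.mpr b.2⟩ =
    FiberCone.mk I ⟨Polynomial.monomial (i + j) (a.1 * b.1), reesAlgebra.monomial_mem.mpr h⟩
  rw [← map_mul]
  exact congrArg _ (Subtype.ext (Polynomial.monomial_mul_monomial i j a.1 b.1))

theorem monomial_mem_map {i : ℕ} {r : MvPolynomial (Fin n) K}
    (hr : r ∈ gradedMaximalIdeal K n * I ^ i) :
    ∃ h : r ∈ I ^ i, (⟨Polynomial.monomial i r, reesAlgebra.monomial_mem.mpr h⟩ :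
      reesAlgebra I) ∈ (gradedMaximalIdeal K n).map
        (algebraMap (MvPolynomial (Fin n) K) (reesAlgebra I)) := by
  induction hr using Submodule.mul_induction_on' with
  | mem_mul_mem a ha b hb =>
    refine ⟨Ideal.mul_mem_left _ _ hb, ?_⟩
    have h1 := Ideal.mul_mem_right (⟨Polynomial.monomial i b, reesAlgebra.monomial_mem.mpr hb⟩ :
      reesAlgebra I) _ (Ideal.mem_map_of_mem
        (algebraMap (MvPolynomial (Fin n) K) (reesAlgebra I)) ha)
    convert h1 using 1
    refine Subtype.ext ?_
    change _ = Polynomial.C a * Polynomial.monomial i b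
    rw [Polynomial.C_mul_monomial]
  | add x _ y _ hx hy =>
    refine ⟨add_mem hx.1 hy.1, ?_⟩
    convert add_mem hx.2 hy.2 using 1
    exact Subtype.ext (map_add _ _ _)

theorem mem_map_gradedMaximalIdeal_iff (f : reesAlgebra I) :
    f ∈ (gradedMaximalIdeal K n).map (algebraMap (MvPolynomial (Fin n) K) (reesAlgebra I)) ↔
      ∀ i, f.1.coeff i ∈ gradedMaximalIdeal K n * I ^ i := by
  constructor
  · intro hf
    induction hf using Submodule.span_induction with
    | mem x hx =>
      obtain ⟨a, ha, rfl⟩ := hx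
      intro i
      change (Polynomial.C a).coeff i ∈ _
      rw [Polynomial.coeff_C]
      split_ifs with hi
      · subst hi
        simpa using ha
      · exact zero_mem _
    | zero => intro i; exact zero_mem _
    | add x y _ _ hx hy =>
      intro i
      change (x.1 + y.1).coeff i ∈ _
      rw [Polynomial.coeff_add]
      exact add_mem (hx i) (hy i)
    | smul a x _ hx =>
      intro i
      change (a.1 * x.1).coeff i ∈ _
      rw [Polynomial.coeff_mul]
      refine sum_mem fun p hp => ?_
      rw [← Finset.HasAntidiagonal.mem_antidiagonal.mp hp, pow_add, mul_left_comm]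
      exact Ideal.mul_mem_mul (a.2 p.1) (hx p.2)
  · intro hf
    have h1 : f = ∑ i ∈ f.1.support, ⟨Polynomial.monomial i (f.1.coeff i),
        reesAlgebra.monomial_mem.mpr (f.2 i)⟩ := by
      refine Subtype.ext ?_
      rw [AddSubmonoidClass.coe_finsetSum]
      exact f.1.as_sum_support
    rw [h1]
    exact sum_mem fun i _ => (monomial_mem_map I (hf i)).2

theorem FiberCone.mk_eq_zero_iff (f : reesAlgebra I) :
    FiberCone.mk I f = 0 ↔ ∀ i, f.1.coeff i ∈ gradedMaximalIdeal K n * I ^ i := by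
  rw [← mem_map_gradedMaximalIdeal_iff]
  exact Ideal.Quotient.eq_zero_iff_mem

theorem FiberCone.mk_surjective : Function.Surjective (FiberCone.mk I) :=
  Ideal.Quotient.mk_surjective

theorem FiberCone.component_eq_zero_iff {k : ℕ} (r : ↥(I ^ k)) :
    FiberCone.component I k r = 0 ↔ r.1 ∈ gradedMaximalIdeal K n * I ^ k := by
  change FiberCone.mk I _ = 0 ↔ _
  rw [FiberCone.mk_eq_zero_iff]
  simp only [Polynomial.coeff_monomial]
  constructor
  · intro h
    simpa using h k
  · intro h i
    split_ifs with hi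
    · exact hi ▸ h
    · exact zero_mem _

theorem FiberCone.mk_eq_sum (f : reesAlgebra I) :
    FiberCone.mk I f = ∑ i ∈ f.1.support, FiberCone.component I i ⟨f.1.coeff i, f.2 i⟩ := by
  have h1 : f = ∑ i ∈ f.1.support, ⟨Polynomial.monomial i (f.1.coeff i),
      reesAlgebra.monomial_mem.mpr (f.2 i)⟩ := by
    refine Subtype.ext ?_
    rw [AddSubmonoidClass.coe_finsetSum]
    exact f.1.as_sum_support
  conv_lhs => rw [h1, map_sum]
  rfl

instance : SetLike.GradedMonoid (fiberConeGrading I) where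
  one_mem := by
    refine ⟨1, by simp, ?_⟩
    rw [← map_one (FiberCone.mk I)]
    rfl
  mul_mem := by
    rintro i j _ _ ⟨r, hr, rfl⟩ ⟨s, hs, rfl⟩
    refine ⟨r * s, by rw [pow_add]; exact Ideal.mul_mem_mul hr hs, ?_⟩
    rw [← map_mul]
    exact congrArg _ (Subtype.ext (Polynomial.monomial_mul_monomial i j r s).symm)

theorem FiberCone.isInternal : DirectSum.IsInternal (fiberConeGrading I) := by
  classical
  constructor
  · rw [injective_iff_map_eq_zero]
    intro x hx
    choose r hr hrx using fun i => (x i).2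
    rw [DirectSum.coeAddMonoidHom_eq_dfinsuppSum, DFinsupp.sum] at hx
    let f : reesAlgebra I := ∑ i ∈ DFinsupp.support x,
      ⟨Polynomial.monomial i (r i), reesAlgebra.monomial_mem.mpr (hr i)⟩
    have hf : FiberCone.mk I f = 0 := by
      rw [map_sum, ← hx]
      exact Finset.sum_congr rfl fun i _ => hrx i
    rw [FiberCone.mk_eq_zero_iff] at hf
    refine DFinsupp.ext fun i => Subtype.ext ?_
    by_contra hne
    have hi : i ∈ DFinsupp.support x := by
      rw [DFinsupp.mem_support_iff]
      exact fun h => hne (congrArg Subtype.val h)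
    have h2 := hf i
    have h3 : f.1.coeff i = r i := by
      rw [AddSubmonoidClass.coe_finsetSum, Polynomial.finsetSum_coeff]
      simp only [Polynomial.coeff_monomial]
      rw [Finset.sum_ite_eq', if_pos hi]
    rw [h3] at h2
    exact hne ((hrx i).symm.trans ((FiberCone.component_eq_zero_iff I ⟨r i, hr i⟩).mpr h2))
  · intro x
    obtain ⟨f, rfl⟩ := FiberCone.mk_surjective I x
    rw [FiberCone.mk_eq_sum]
    refine ⟨∑ i ∈ f.1.support, DirectSum.of (fun i => fiberConeGrading I i) i
      ⟨FiberCone.component I i ⟨f.1.coeff i, f.2 i⟩, FiberCone.component_mem I _⟩, ?_⟩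
    rw [map_sum]
    exact Finset.sum_congr rfl fun i _ => DirectSum.coeAddMonoidHom_of _ _ _

noncomputable instance : DirectSum.Decomposition (fiberConeGrading I) :=
  (FiberCone.isInternal I).chooseDecomposition

noncomputable instance : GradedAlgebra (fiberConeGrading I) where

theorem fiberConeGrading_eq_span {k : ℕ} {T : Set (MvPolynomial (Fin n) K)}
    (hT : Ideal.span T = I ^ k) : fiberConeGrading I k =
      Submodule.span K (Set.range fun t : T => FiberCone.component I k
        ⟨t.1, hT ▸ Ideal.subset_span t.2⟩) := by
  apply le_antisymm
  · rintro _ ⟨r, hr, rfl⟩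
    set M := Submodule.span K (Set.range fun t : T => FiberCone.component I k
        ⟨t.1, hT ▸ Ideal.subset_span t.2⟩)
    suffices h : ∃ h : r ∈ I ^ k, FiberCone.component I k ⟨r, h⟩ ∈ M from h.2
    rw [← hT] at hr
    induction hr using Submodule.closure_induction with
    | zero =>
      refine ⟨zero_mem _, ?_⟩
      convert zero_mem M
      exact map_zero _
    | add x y _ _ hx hy =>
      refine ⟨add_mem hx.1 hy.1, ?_⟩
      convert add_mem hx.2 hy.2
      exact map_add (FiberCone.component I k) ⟨x, hx.1⟩ ⟨y, hy.1⟩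
    | smul_mem s t ht =>
      have htk : t ∈ I ^ k := hT ▸ Ideal.subset_span ht
      refine ⟨Ideal.mul_mem_left _ _ htk, ?_⟩
      have h1 : FiberCone.component I k ⟨s • t, Ideal.mul_mem_left _ _ htk⟩ =
          coeff 0 s • FiberCone.component I k ⟨t, htk⟩ := by
        rw [← map_smul, ← sub_eq_zero, ← map_sub, FiberCone.component_eq_zero_iff]
        change s * t - coeff 0 s • t ∈ _
        rw [MvPolynomial.smul_eq_C_mul, ← sub_mul]
        exact Ideal.mul_mem_mul (sub_C_mem_gradedMaximalIdeal s) htk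
      rw [h1]
      exact M.smul_mem _ (Submodule.subset_span ⟨⟨t, ht⟩, rfl⟩)
  · rw [Submodule.span_le]
    rintro _ ⟨t, rfl⟩
    exact FiberCone.component_mem I _

theorem finite_fiberConeGrading (k : ℕ) : Module.Finite K (fiberConeGrading I k) := by
  obtain ⟨T, hT⟩ := (inferInstance : IsNoetherian (MvPolynomial (Fin n) K)
    (MvPolynomial (Fin n) K)).noetherian (I ^ k)
  rw [fiberConeGrading_eq_span I hT]
  exact Module.Finite.span_of_finite K (Set.finite_range _)

theorem finrank_fiberConeGrading_le (k : ℕ) :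
    Module.finrank K (fiberConeGrading I k) ≤ mu (I ^ k) := by
  obtain ⟨T, hcard, hT⟩ := Submodule.FG.exists_span_finset_card_eq_spanFinrank
    ((inferInstance : IsNoetherian (MvPolynomial (Fin n) K)
      (MvPolynomial (Fin n) K)).noetherian (I ^ k))
  rw [fiberConeGrading_eq_span I hT, mu, ← hcard]
  refine (finrank_range_le_card _).trans ?_
  simp

theorem isStandardGraded_fiberConeGrading : IsStandardGraded (fiberConeGrading I) where
  nontrivial := by
    refine ⟨1, 0, fun h => ?_⟩
    rw [← map_one (FiberCone.mk I), FiberCone.mk_eq_zero_iff] at h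
    have h0 : (1 : MvPolynomial (Fin n) K) ∈ gradedMaximalIdeal K n := by
      have := h 0
      rw [pow_zero, Ideal.one_eq_top, Ideal.mul_top] at this
      change (1 : Polynomial (MvPolynomial (Fin n) K)).coeff 0 ∈ _ at this
      simpa using this
    rw [gradedMaximalIdeal_eq, ← pow_one (idealOfVars _ _), mem_pow_idealOfVars_iff'] at h0
    simpa using h0 0 (by simp)
  zero_le := by
    rw [fiberConeGrading_eq_span I (T := {1}) (by simp), Submodule.span_le]
    rintro _ ⟨⟨t, rfl⟩, rfl⟩
    exact Submodule.mem_one.mpr ⟨1, by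
      rw [map_one, ← map_one (FiberCone.mk I)]
      rfl⟩
  adjoin_one := by
    have h : ∀ k, fiberConeGrading I k ≤ Subalgebra.toSubmodule
        (Algebra.adjoin K (fiberConeGrading I 1 : Set (FiberCone I))) := by
      intro k
      induction k with
      | zero =>
        rw [fiberConeGrading_eq_span I (T := {1}) (by simp), Submodule.span_le]
        rintro _ ⟨⟨t, rfl⟩, rfl⟩
        convert one_mem (Algebra.adjoin K (fiberConeGrading I 1 : Set (FiberCone I)))
        rw [← map_one (FiberCone.mk I)]
        rfl
      | succ k ih =>
        have hT : Ideal.span (Set.image2 (· * ·)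
            ((I ^ k : Ideal (MvPolynomial (Fin n) K)) : Set (MvPolynomial (Fin n) K))
            (I : Set (MvPolynomial (Fin n) K))) = I ^ (k + 1) := by
          rw [Set.image2_mul, ← Ideal.span_mul_span', Ideal.span_eq, Ideal.span_eq, pow_succ]
        rw [fiberConeGrading_eq_span I hT, Submodule.span_le]
        rintro _ ⟨⟨_, ⟨a, ha, b, hb, rfl⟩⟩, rfl⟩
        have hb' : b ∈ I ^ 1 := by rwa [pow_one]
        have h1 := Subalgebra.mul_mem _ (ih (FiberCone.component_mem I ⟨a, ha⟩))
          (Algebra.subset_adjoin (R := K) (FiberCone.component_mem I ⟨b, hb'⟩))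
        have h2 : FiberCone.component I (k + 1)
              ⟨a * b, hT ▸ Ideal.subset_span ⟨a, ha, b, hb, rfl⟩⟩ =
            FiberCone.component I k ⟨a, ha⟩ * FiberCone.component I 1 ⟨b, hb'⟩ := by
          exact (FiberCone.component_mul I ⟨a, ha⟩ ⟨b, hb'⟩ _).symm
        rw [← h2] at h1
        exact h1
    rw [eq_top_iff]
    intro x _
    classical
    rw [← DirectSum.sum_support_decompose (fiberConeGrading I) x]
    exact sum_mem fun i _ => h i (SetLike.coe_mem _)
  finite_one := finite_fiberConeGrading I 1

variable {I}

theorem IsEquigeneratedMonomial.mul {J : Ideal (MvPolynomial (Fin n) K)}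
    (hI : IsEquigeneratedMonomial I) (hJ : IsEquigeneratedMonomial J) :
    IsEquigeneratedMonomial (I * J) := by
  obtain ⟨d, A, hA, rfl⟩ := hI
  obtain ⟨e, B, hB, rfl⟩ := hJ
  refine ⟨d + e, Set.image2 (· + ·) A B, ?_, ?_⟩
  · rintro _ ⟨a, ha, b, hb, rfl⟩
    rw [map_add, hA a ha, hB b hb]
  · rw [Ideal.span_mul_span']
    congr 1
    rw [← Set.image2_mul, Set.image2_image_left, Set.image2_image_right, Set.image_image2]
    simp [monomial_mul]

theorem finrank_fiberConeGrading {k : ℕ} (h : IsEquigeneratedMonomial (I ^ k)) :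
    Module.finrank K (fiberConeGrading I k) = mu (I ^ k) := by
  classical
  refine le_antisymm (finrank_fiberConeGrading_le I k) ?_
  obtain ⟨d, A, hA, hIA⟩ := h
  have hAfin : A.Finite := (Finsupp.finite_of_degree_le d).subset fun a ha => (hA a ha).le
  have hmu : mu (I ^ k) ≤ A.ncard := by
    rw [mu, hIA]
    exact (Submodule.spanFinrank_span_le_ncard_of_finite (hAfin.image _)).trans
      (Set.ncard_image_le hAfin)
  refine hmu.trans ?_
  have hmem : ∀ a : A, monomial a.1 (1 : K) ∈ I ^ k := fun a =>
    hIA ▸ Ideal.subset_span ⟨a.1, a.2, rfl⟩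
  have hle : gradedMaximalIdeal K n * I ^ k ≤ idealOfVars (Fin n) K ^ (d + 1) := by
    rw [pow_succ', gradedMaximalIdeal_eq]
    refine Ideal.mul_mono_right ?_
    rw [hIA, Ideal.span_le]
    rintro _ ⟨a, ha, rfl⟩
    exact (monomial_mem_pow_idealOfVars_iff d a one_ne_zero).mpr (hA a ha).ge
  let v : A → fiberConeGrading I k := fun a =>
    ⟨FiberCone.component I k ⟨monomial a.1 1, hmem a⟩, FiberCone.component_mem I _⟩
  have hfin : Fintype A := hAfin.fintype
  have hli : LinearIndependent K v := by
    rw [Fintype.linearIndependent_iff]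
    intro g hg a
    have h1 : FiberCone.component I k (∑ a, g a • ⟨monomial a.1 1, hmem a⟩) = 0 := by
      rw [map_sum]
      have h0 := congrArg Subtype.val hg
      rw [AddSubmonoidClass.coe_finsetSum] at h0
      simp only [map_smul]
      exact h0
    rw [FiberCone.component_eq_zero_iff] at h1
    have h2 := (mem_pow_idealOfVars_iff' _ _).mp (hle h1) a.1 (by rw [hA a.1 a.2]; omega)
    rw [AddSubmonoidClass.coe_finsetSum, coeff_sum] at h2
    simpa [coeff_monomial, ← Subtype.ext_iff] using h2
  have := finite_fiberConeGrading I k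
  have h3 := hli.fintype_card_le_finrank
  rwa [← Nat.card_eq_fintype_card, Nat.card_coe_set_eq] at h3

end FiberConeGraded

section PolynomialRing

open RingTheory.Sequence

/-- Every maximal ideal of `A` contains a weakly regular sequence of length `d`. -/
def HasRegularSequences (A : Type*) [CommRing A] (d : ℕ) : Prop :=
  ∀ P : Ideal A, P.IsMaximal → ∃ rs : List A, rs.length = d ∧ (∀ r ∈ rs, r ∈ P) ∧
    IsWeaklyRegular A rs

theorem HasRegularSequences.of_ringEquiv {A B : Type*} [CommRing A] [CommRing B] {d : ℕ}
    (h : HasRegularSequences A d) (e : A ≃+* B) : HasRegularSequences B d := by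
  intro P hP
  obtain ⟨rs, h1, h2, h3⟩ := h (P.comap e) (Ideal.comap_isMaximal_of_equiv e)
  refine ⟨rs.map e, by simp [h1], ?_, ?_⟩
  · intro r hr
    obtain ⟨s, hs, rfl⟩ := List.mem_map.mp hr
    exact h2 s hs
  · refine (AddEquiv.isWeaklyRegular_congr (e := e.toAddEquiv) ?_).mp h3
    refine List.forall₂_map_right_iff.mpr (List.forall₂_same.mpr fun r _ x => ?_)
    exact map_mul e r x

open Polynomial in
theorem exists_monic_mem_of_isMaximal {A : Type*} [CommRing A] [IsJacobsonRing A] (P : Ideal A[X])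
    (hP : P.IsMaximal) : ∃ f ∈ P, f.Monic := by
  let _ := Ideal.Quotient.field P
  obtain ⟨p, hp, hp0⟩ := Polynomial.comp_C_integral_of_surjective_of_isJacobsonRing
    (Ideal.Quotient.mk P) Ideal.Quotient.mk_surjective (Ideal.Quotient.mk P X)
  refine ⟨p, ?_, hp⟩
  rw [← Ideal.Quotient.eq_zero_iff_mem]
  rw [← Polynomial.hom_eval₂, Polynomial.eval₂_C_X] at hp0
  exact hp0

open Polynomial in
theorem HasRegularSequences.polynomial {A : Type*} [CommRing A] [IsJacobsonRing A] {d : ℕ}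
    (h : HasRegularSequences A d) : HasRegularSequences A[X] (d + 1) := by
  intro P hP
  obtain ⟨f, hfP, hf⟩ := exists_monic_mem_of_isMaximal P hP
  obtain ⟨rs, h1, h2, h3⟩ := h (P.comap C) (Polynomial.isMaximal_comap_C_of_isJacobsonRing P)
  refine ⟨rs.map C ++ [f], by simp [h1], ?_, ?_⟩
  · intro r hr
    rw [List.mem_append, List.mem_singleton] at hr
    rcases hr with hr | rfl
    · obtain ⟨s, hs, rfl⟩ := List.mem_map.mp hr
      exact h2 s hs
    · exact hfP
  · rw [isWeaklyRegular_append_iff, isWeaklyRegular_singleton_iff]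
    refine ⟨h3.of_flat (S := A[X]), ?_⟩
    refine isSMulRegular_iff_right_eq_zero_of_smul.mpr fun u hu => ?_
    obtain ⟨u, rfl⟩ := Submodule.Quotient.mk_surjective _ u
    rw [← Submodule.Quotient.mk_smul] at hu
    rw [Submodule.Quotient.mk_eq_zero] at hu ⊢
    rw [smul_eq_mul, Ideal.mul_top, ← Ideal.map_ofList, ← Ideal.mk_ker (I := Ideal.ofList rs),
      ← Polynomial.ker_mapRingHom, RingHom.mem_ker] at hu ⊢
    rw [smul_eq_mul, map_mul] at hu
    exact (hf.map (Ideal.Quotient.mk (Ideal.ofList rs))).mul_right_eq_zero_iff.mp hu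

theorem hasRegularSequences_mvPolynomial (K : Type*) [Field K] (m : ℕ) :
    HasRegularSequences (MvPolynomial (Fin m) K) m := by
  induction m with
  | zero => exact fun P _ => ⟨[], rfl, by simp, by simp⟩
  | succ m ih => exact ih.polynomial.of_ringEquiv (MvPolynomial.finSuccEquiv K m).symm.toRingEquiv

theorem finrank_homogeneousSubmodule (K : Type*) [Field K] (m j : ℕ) :
    Module.finrank K (MvPolynomial.homogeneousSubmodule (Fin m) K j) = Nat.multichoose m j := by
  rw [MvPolynomial.homogeneousSubmodule_eq_finsupp_supported]
  have b := MvPolynomial.basisRestrictSupport K {d : Fin m →₀ ℕ | d.degree = j}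
  have e : {d : Fin m →₀ ℕ | d.degree = j} ≃ Sym (Fin m) j :=
    (Equiv.subtypeEquivRight fun d => by
      simp [Finsupp.degree_eq_sum, Finsupp.sum_fintype]).trans (Sym.equivNatSum (Fin m) j).symm
  refine (Module.finrank_eq_nat_card_basis b).trans ?_
  rw [Nat.card_congr e, Nat.card_eq_fintype_card, Sym.card_sym_eq_multichoose, Fintype.card_fin]

end PolynomialRing

section Quadric

attribute [local instance] MvPolynomial.gradedAlgebra

open RingTheory.Sequence MvPolynomial

variable {K R : Type*} [Field K] [CommRing R] [Algebra K R] {𝒜 : ℕ → Submodule K R}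
  [GradedAlgebra 𝒜]

theorem eq_map_homogeneousSubmodule {m : ℕ} {φ : MvPolynomial (Fin m) K →ₐ[K] R}
    (hφ : Function.Surjective φ) (hX : ∀ i, φ (X i) ∈ 𝒜 1) (j : ℕ) :
    𝒜 j = (homogeneousSubmodule (Fin m) K j).map φ.toLinearMap := by
  classical
  have hle : ∀ j, (homogeneousSubmodule (Fin m) K j).map φ.toLinearMap ≤ 𝒜 j := by
    intro j
    rw [← homogeneousSubmodule_one_pow, Submodule.map_pow]
    refine (pow_le_pow_left' ?_ j).trans (IsStandardGraded.pow_le j)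
    rw [homogeneousSubmodule_one_eq_span_X, Submodule.map_span_le]
    rintro _ ⟨i, rfl⟩
    exact hX i
  refine le_antisymm (fun x hx => ?_) (hle j)
  obtain ⟨p, rfl⟩ := hφ x
  rw [← DirectSum.decompose_of_mem_same 𝒜 hx]
  conv => rw [← DirectSum.sum_support_decompose (homogeneousSubmodule (Fin m) K) p]
  rw [map_sum, DirectSum.decompose_sum, DFinsupp.finsetSum_apply, AddSubmonoidClass.coe_finsetSum]
  refine sum_mem fun i _ => ?_
  have hi : φ (DirectSum.decompose (homogeneousSubmodule (Fin m) K) p i) ∈ 𝒜 i :=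
    hle i ⟨_, SetLike.coe_mem _, rfl⟩
  by_cases hij : i = j
  · subst hij
    rw [DirectSum.decompose_of_mem_same 𝒜 hi]
    exact ⟨_, SetLike.coe_mem _, rfl⟩
  · rw [DirectSum.decompose_of_mem_ne 𝒜 hi hij]
    exact zero_mem _

/-- The first values of the Hilbert function of a quadric hypersurface. -/
theorem finrank_quadric {m : ℕ} {φ : MvPolynomial (Fin m) K →ₐ[K] R}
    {q : MvPolynomial (Fin m) K} (hφ : Function.Surjective φ) (hX : ∀ i, φ (X i) ∈ 𝒜 1)
    (hq0 : q ≠ 0) (hq : q.IsHomogeneous 2) (hker : RingHom.ker φ = Ideal.span {q}) :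
    Module.finrank K (𝒜 1) = m ∧ Module.finrank K (𝒜 2) + 1 = Nat.multichoose m 2 := by
  have hfin : ∀ j, Module.Finite K (homogeneousSubmodule (Fin m) K j) := fun j =>
    Module.Finite.iff_fg.mpr (homogeneousSubmodule_fg _ _ j)
  have hmem : ∀ p, p ∈ LinearMap.ker φ.toLinearMap ↔ ∃ b, b * q = p := by
    intro p
    rw [← Ideal.mem_span_singleton', ← hker]
    rfl
  have hq' : q ∈ homogeneousSubmodule (Fin m) K 2 := hq
  have h1 := finrank_map_add_finrank_inf_ker (homogeneousSubmodule (Fin m) K 1) φ.toLinearMap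
  have h2 := finrank_map_add_finrank_inf_ker (homogeneousSubmodule (Fin m) K 2) φ.toLinearMap
  have h3 : homogeneousSubmodule (Fin m) K 1 ⊓ LinearMap.ker φ.toLinearMap = ⊥ := by
    rw [eq_bot_iff]
    rintro p ⟨hp, hpk⟩
    obtain ⟨b, rfl⟩ := (hmem p).mp hpk
    have h4 := DirectSum.decompose_of_mem_same (homogeneousSubmodule (Fin m) K) hp
    rw [DirectSum.coe_decompose_mul_of_right_mem_of_not_le _ hq' (by simp)] at h4
    exact h4.symm
  have h5 : homogeneousSubmodule (Fin m) K 2 ⊓ LinearMap.ker φ.toLinearMap =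
      Submodule.span K {q} := by
    apply le_antisymm
    · rintro p ⟨hp, hpk⟩
      obtain ⟨b, rfl⟩ := (hmem p).mp hpk
      have h4 := DirectSum.decompose_of_mem_same (homogeneousSubmodule (Fin m) K) hp
      have h6 := DirectSum.coe_decompose_mul_add_of_right_mem (homogeneousSubmodule (Fin m) K)
        (i := 0) (a := b) hq'
      have h7 := SetLike.coe_mem (DirectSum.decompose (homogeneousSubmodule (Fin m) K) b 0)
      obtain ⟨c, hc⟩ := Submodule.mem_one.mp ((homogeneousSubmodule_zero (R := K) _).le h7)
      rw [zero_add, h4, ← hc] at h6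
      rw [h6, Submodule.mem_span_singleton]
      exact ⟨c, Algebra.smul_def _ _⟩
    · rw [Submodule.span_singleton_le_iff_mem]
      exact ⟨hq', (hmem q).mpr ⟨1, one_mul q⟩⟩
  rw [← eq_map_homogeneousSubmodule hφ hX, h3, finrank_bot, finrank_homogeneousSubmodule] at h1
  rw [← eq_map_homogeneousSubmodule hφ hX, h5, finrank_span_singleton hq0,
    finrank_homogeneousSubmodule] at h2
  exact ⟨by simpa using h1, h2⟩

end Quadric

section QuadricCohenMacaulay

universe u

open RingTheory.Sequence Pointwise

/-- A hypersurface ring over a field is Cohen-Macaulay. -/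
theorem isCohenMacaulayRing_of_ker_eq_span {K : Type u} {R : Type*} [Field K] [CommRing R]
    [Algebra K R] [Nontrivial R] {m : ℕ} (φ : MvPolynomial (Fin (m + 1)) K →ₐ[K] R)
    (hφ : Function.Surjective φ) {q : MvPolynomial (Fin (m + 1)) K} (hq0 : q ≠ 0)
    (hker : RingHom.ker φ = Ideal.span {q}) :
    IsCohenMacaulayRing R ∧ krullDim R = m := by
  have hnoeth : IsNoetherianRing R := isNoetherianRing_of_surjective _ _ φ.toRingHom hφ
  have hφq : φ q = 0 := by
    rw [← RingHom.mem_ker, hker]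
    exact Ideal.mem_span_singleton_self q
  have hdim : ringKrullDim R ≤ m := by
    have h := ringKrullDim_succ_le_of_surjective φ.toRingHom hφ
      (mem_nonZeroDivisors_of_ne_zero hq0) hφq
    rw [MvPolynomial.ringKrullDim_of_isNoetherianRing, ringKrullDim_eq_zero_of_field, zero_add,
      Nat.card_eq_fintype_card, Fintype.card_fin] at h
    generalize ringKrullDim R = x at h
    induction x with
    | bot => exact bot_le
    | coe x =>
      norm_cast at h ⊢
      induction x with
      | top => simp at h
      | coe x =>
        norm_cast at h ⊢
        omega
  have hloc : ∀ p : Ideal R, [p.IsMaximal] → ∃ rs : List (Localization.AtPrime p),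
      rs.length = m ∧ (∀ r ∈ rs, r ∈ IsLocalRing.maximalIdeal (Localization.AtPrime p)) ∧
      IsRegular (Localization.AtPrime p) rs := by
    intro p hp
    let B := MvPolynomial (Fin (m + 1)) K
    let _ : Algebra B R := φ.toRingHom.toAlgebra
    have hmax : (p.comap φ.toRingHom).IsMaximal := Ideal.comap_isMaximal_of_surjective _ hφ
    obtain ⟨rs, h1, h2, h3⟩ := hasRegularSequences_mvPolynomial K (m + 1) _ hmax
    have hlt : p.comap φ.toRingHom • (⊤ : Submodule B B) < ⊤ := by
      rw [lt_top_iff_ne_top, smul_eq_mul, Ideal.mul_top]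
      exact hmax.ne_top
    have hreg : IsRegular B rs := ⟨h3, fun h => by
      refine hmax.ne_top (top_le_iff.mp ?_)
      rw [smul_eq_mul, Ideal.mul_top] at h
      rw [h]
      exact Ideal.span_le.mpr h2⟩
    have hqp : q ∈ p.comap φ.toRingHom := by
      change φ q ∈ p
      rw [hφq]
      exact zero_mem _
    obtain ⟨rs', h4, h5, h6⟩ := exists_isRegular_quotSMulTop _ B hlt h1 h2 hreg hqp
      (IsSMulRegular.of_ne_zero hq0)
    let e : QuotSMulTop q B ≃ₗ[B] R :=
      (Submodule.quotEquivOfEq _ _ (by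
        rw [← Submodule.ideal_span_singleton_smul, smul_eq_mul, Ideal.mul_top, ← hker]
        rfl)).trans ((Algebra.linearMap B R).quotKerEquivOfSurjective hφ)
    have h7 : IsWeaklyRegular R (rs'.map (algebraMap B R)) :=
      (isWeaklyRegular_map_algebraMap_iff R R rs').mpr ((e.isWeaklyRegular_congr rs').mp h6.1)
    have h8 : ∀ r ∈ rs'.map (algebraMap B R), r ∈ p := by
      intro r hr
      obtain ⟨s, hs, rfl⟩ := List.mem_map.mp hr
      exact h5 s hs
    refine ⟨_, by simp [h4], ?_,
      h7.isRegular_of_isLocalization_of_mem (Localization.AtPrime p) p h8⟩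
    intro r hr
    obtain ⟨s, hs, rfl⟩ := List.mem_map.mp hr
    exact (IsLocalization.AtPrime.to_map_mem_maximal_iff _ p s).mpr (h8 s hs)
  have hle : ∀ p : Ideal R, [p.IsMaximal] → ringKrullDim (Localization.AtPrime p) ≤
      ringKrullDim R := by
    intro p hp
    rw [IsLocalization.AtPrime.ringKrullDim_eq_height p]
    exact Ideal.height_le_ringKrullDim_of_ne_top hp.ne_top
  have hN : ∀ p : Ideal R, [p.IsMaximal] → IsNoetherianRing (Localization.AtPrime p) :=
    fun p _ => IsLocalization.isNoetherianRing p.primeCompl _ hnoeth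
  refine ⟨⟨hnoeth, fun p hp => ?_⟩, ?_⟩
  · have := hN p
    obtain ⟨rs, h1, h2, h3⟩ := hloc p
    exact isCohenMacaulayLocalRing_of_isRegular h2 h3 (h1.symm ▸ (hle p).trans hdim)
  · obtain ⟨p, hp⟩ := Ideal.exists_maximal R
    have := hN p
    obtain ⟨rs, h1, h2, h3⟩ := hloc p
    have h4 : ringKrullDim R = m := le_antisymm hdim
      (h1 ▸ (isRegular_length_le_ringKrullDim h3).trans (hle p))
    rw [krullDim, h4]
    rfl

end QuadricCohenMacaulay

section Freiman

/-- The coefficients of a power series in terms of the numerator of its rational expression. -/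
theorem coeff_of_mul_one_sub_X_pow {H P : PowerSeries ℤ} (d : ℕ)
    (h : H * (1 - PowerSeries.X) ^ d = P) :
    H.coeff 0 = P.coeff 0 ∧ H.coeff 1 = P.coeff 1 + d * P.coeff 0 ∧
      H.coeff 2 = P.coeff 2 + d * P.coeff 1 + (d + 1).choose 2 * P.coeff 0 := by
  induction d generalizing H with
  | zero => simp_all
  | succ d ih =>
    rw [pow_succ', ← mul_assoc] at h
    obtain ⟨h0, h1, h2⟩ := ih h
    have c0 : (H * (1 - PowerSeries.X)).coeff 0 = H.coeff 0 := by simp [mul_sub]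
    have c : ∀ k, (H * (1 - PowerSeries.X)).coeff (k + 1) = H.coeff (k + 1) - H.coeff k := by
      intro k
      rw [mul_sub, mul_one, map_sub, PowerSeries.coeff_succ_mul_X]
    rw [c0] at h0
    rw [c 0] at h1
    rw [c 1] at h2
    have hc : ((d + 1 + 1).choose 2 : ℤ) = (d + 1) + (d + 1).choose 2 := by
      rw [Nat.choose_succ_succ' (d + 1) 1, Nat.choose_one_right]
      push_cast
      ring
    refine ⟨h0, ?_, ?_⟩
    · push_cast
      linarith
    · rw [hc]
      push_cast
      simp only [zero_add, one_add_one_eq_two] at h1 h2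
      linarith

variable {K R : Type*} [Field K] [CommRing R] [Algebra K R] {𝒜 : ℕ → Submodule K R}
  [GradedAlgebra 𝒜]

omit [GradedAlgebra 𝒜] in
theorem IsStandardGraded.finrank_zero (h : IsStandardGraded 𝒜) [SetLike.GradedMonoid 𝒜] :
    Module.finrank K (𝒜 0) = 1 := by
  have := h.nontrivial
  have h1 : 𝒜 0 = Submodule.span K {1} := by
    rw [← Submodule.one_eq_span]
    exact le_antisymm h.zero_le (Submodule.one_le.mpr SetLike.GradedOne.one_mem)
  rw [h1, finrank_span_singleton one_ne_zero]

theorem two_mul_choose_two (d : ℕ) : 2 * (d.choose 2 : ℤ) = d * (d - 1) := by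
  induction d with
  | zero => simp
  | succ d ih =>
    rw [Nat.choose_succ_succ' d 1, Nat.choose_one_right]
    push_cast
    linarith

omit [GradedAlgebra 𝒜] in
theorem hasMultiplicity_unique {e e' : ℤ} (h : HasMultiplicity 𝒜 e) (h' : HasMultiplicity 𝒜 e') :
    e = e' := by
  obtain ⟨Q, hQ, rfl⟩ := h
  obtain ⟨Q', hQ', rfl⟩ := h'
  rw [Polynomial.coe_injective ℤ (hQ.symm.trans hQ')]

/-- A standard graded Cohen-Macaulay algebra has minimal multiplicity if and only if the value of
its Hilbert function in degree two is as small as possible. -/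
theorem IsStandardGraded.hasMinimalMultiplicity_iff (h : IsStandardGraded 𝒜)
    (hCM : IsCohenMacaulayRing R) :
    HasMinimalMultiplicity 𝒜 ↔ (Module.finrank K (𝒜 2) : ℤ) =
      krullDim R * Module.finrank K (𝒜 1) - (krullDim R).choose 2 := by
  obtain ⟨hv, ⟨N, hN⟩, h2, hser⟩ := h.exists_hVector hCM
  obtain ⟨c0, c1, c2⟩ := coeff_of_mul_one_sub_X_pow _ hser
  simp only [hilbertSeries, PowerSeries.coeff_mk, h.finrank_zero] at c0 c1 c2
  let Q : Polynomial ℤ := ∑ k ∈ Finset.range (N + 2), Polynomial.monomial k (hv k : ℤ)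
  have hQ : (Q : PowerSeries ℤ) = PowerSeries.mk fun k => (hv k : ℤ) := by
    ext k
    rw [Polynomial.coeff_coe, PowerSeries.coeff_mk, Polynomial.finsetSum_coeff]
    simp only [Polynomial.coeff_monomial]
    rw [Finset.sum_ite_eq']
    split_ifs with hk
    · rfl
    · rw [hN k (by simp at hk; omega)]
      rfl
  have hmult : HasMultiplicity 𝒜 (∑ k ∈ Finset.range (N + 2), (hv k : ℤ)) := by
    refine ⟨Q, by rw [hQ, hser], ?_⟩
    simp [Q, Polynomial.eval_finsetSum]
  have hsum : ∑ k ∈ Finset.range (N + 2), (hv k : ℤ) =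
      1 + hv 1 + ∑ k ∈ Finset.range N, (hv (k + 2) : ℤ) := by
    rw [Finset.sum_range_succ', Finset.sum_range_succ', ← c0]
    push_cast
    ring
  have hzero : ∑ k ∈ Finset.range N, (hv (k + 2) : ℤ) = 0 ↔ hv 2 = 0 := by
    rw [Finset.sum_eq_zero_iff_of_nonneg fun k _ => by positivity]
    constructor
    · intro hall
      rcases Nat.eq_zero_or_pos N with rfl | hpos
      · exact hN 2 (by omega)
      · exact_mod_cast hall 0 (Finset.mem_range.mpr hpos)
    · intro h0 k _
      rw [h2 h0 (k + 2) (by omega)]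
      rfl
  have hmin : HasMinimalMultiplicity 𝒜 ↔ hv 2 = 0 := by
    rw [← hzero]
    constructor
    · rintro ⟨e, he, hemb⟩
      rw [hasMultiplicity_unique he hmult, hsum, embDim, c1, ← c0] at hemb
      push_cast at hemb
      linarith
    · intro h0
      refine ⟨_, hmult, ?_⟩
      rw [hsum, h0, embDim, c1, ← c0]
      push_cast
      ring
  rw [hmin, c2, c1, ← c0]
  have e1 := two_mul_choose_two (krullDim R)
  have e2 := two_mul_choose_two (krullDim R + 1)
  push_cast at e2 ⊢
  constructor
  · intro h0
    rw [h0]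
    push_cast
    nlinarith
  · intro h0
    have : (hv 2 : ℤ) = 0 := by nlinarith
    exact_mod_cast this

theorem IsEquigeneratedMonomial.isFreiman_iff {n : ℕ} {I : Ideal (MvPolynomial (Fin n) K)}
    (hI : IsEquigeneratedMonomial I) : IsFreiman I ↔
      (Module.finrank K (fiberConeGrading I 2) : ℤ) = krullDim (FiberCone I) *
        Module.finrank K (fiberConeGrading I 1) - (krullDim (FiberCone I)).choose 2 := by
  rw [finrank_fiberConeGrading (k := 2) (by rw [pow_two]; exact hI.mul hI),
    finrank_fiberConeGrading (k := 1) (by rwa [pow_one]), pow_one]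
  exact ⟨fun h => h.2, fun h => ⟨hI, h⟩⟩

end Freiman

end FreimanIdeal

theorem proposition1p2 {K : Type*} [Field K] {n : ℕ} (I : Ideal (MvPolynomial (Fin n) K))
    (hI : FreimanIdeal.IsEquigeneratedMonomial I) :
    (FreimanIdeal.IsCohenMacaulayRing (FreimanIdeal.FiberCone I) →
      (FreimanIdeal.IsFreiman I ↔
        FreimanIdeal.HasMinimalMultiplicity (FreimanIdeal.fiberConeGrading I))) ∧
    (FreimanIdeal.IsQuadricHypersurface (FreimanIdeal.fiberConeGrading I) →
      FreimanIdeal.IsCohenMacaulayRing (FreimanIdeal.FiberCone I) ∧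
      FreimanIdeal.IsFreiman I ∧
      FreimanIdeal.HasMinimalMultiplicity (FreimanIdeal.fiberConeGrading I)) := by
  have hstd := FreimanIdeal.isStandardGraded_fiberConeGrading I
  have hnt := hstd.nontrivial
  rw [hI.isFreiman_iff]
  refine ⟨fun hCM => (hstd.hasMinimalMultiplicity_iff hCM).symm, ?_⟩
  rintro ⟨m, φ, q, hφ, hX, hq0, hq, hker⟩
  obtain ⟨h1, h2⟩ := FreimanIdeal.finrank_quadric hφ hX hq0 hq hker
  obtain _ | m := m
  · simp at h2
  obtain ⟨hCM, hdim⟩ := FreimanIdeal.isCohenMacaulayRing_of_ker_eq_span φ hφ hq0 hker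
  have hF : (Module.finrank K (FreimanIdeal.fiberConeGrading I 2) : ℤ) =
      FreimanIdeal.krullDim (FreimanIdeal.FiberCone I) *
        Module.finrank K (FreimanIdeal.fiberConeGrading I 1) -
          (FreimanIdeal.krullDim (FreimanIdeal.FiberCone I)).choose 2 := by
    rw [h1, hdim]
    have h3 : (Module.finrank K (FreimanIdeal.fiberConeGrading I 2) : ℤ) + 1 =
        (m + 2).choose 2 := by
      rw [Nat.multichoose_eq] at h2
      exact_mod_cast h2
    have e1 := FreimanIdeal.two_mul_choose_two m
    have e2 := FreimanIdeal.two_mul_choose_two (m + 2)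
    push_cast at e2 ⊢
    nlinarith
  exact ⟨hCM, hF, (hstd.hasMinimalMultiplicity_iff hCM).mpr hF⟩
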